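/- Let $p_1\ge p_2$, let $X_1,\dots,X_n\in\mathbb{R}^{p_1\times p_2}$, $y_1,\dots,y_n\in\mathbb{R}$, $\lambda\in\mathbb{R}$, and write $\langle X,B\rangle=\operatorname{trace}(X^\top B)$. Let $\ell(\cdot\,;y_j)$ be twice continuously differentiable for each $j$, with derivatives $\dot\ell,\ddot\ell$ in the first argument, and let $R(B)=\sum_{j=1}^{\min(p_1,p_2)} r(\sigma_j(B))$, where $\sigma_j(B)$ are the singular values of $B$ and $r$ is twice continuously differentiable on $(0,\infty)$ (for instance an even smooth function on $\mathbb{R}$). Let $$\hat B\in\arg\min_{B}\ \sum_{j=1}^n \ell(\langle X_j,B\rangle;y_j)+\lambda R(B),$$ and let $\hat B=\hat U\,\mathrm{diag}[\hat\sigma]\,\hat V^\top$ be a singular value decomposition with $\hat U\in\mathbb{R}^{p_1\times p_1}$, $\hat V\in\mathbb{R}^{p_2\times p_2}$ orthogonal, with columns $\hat u_k$, $\hat v_l$, where $\mathrm{diag}[\hat\sigma]$ is $p_1\times p_2$. Assume that all $\hat\sigma_j$ are nonzero and pairwise distinct. For each $i$ let $F_{/i}(B)=\sum_{j\ne i}\ell(\langle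 X_j,B\rangle;y_j)+\lambda R(B)$ and let $$\tilde B^{/i}=\hat B-[\nabla^2F_{/i}(\hat B)]^{-1}\nabla F_{/i}(\hat B)$$ be one Newton step for $F_{/i}$ from $\hat B$. Define the $n\times p_1p_2$ matrix $\mathcal X$ and the $p_1p_2\times p_1p_2$ matrix $\mathcal G$ by $\mathcal X_{j,kl}=\hat u_k^\top X_j\hat v_l$ and $$\mathcal G_{kl,st}=\begin{cases}\ddot r(\hat\sigma_t) & s=t=k=l,\\[2pt] \dfrac{\hat\sigma_s\dot r(\hat\sigma_s)-\hat\sigma_t\dot r(\hat\sigma_t)}{\hat\sigma_s^2-\hat\sigma_t^2} & s\ne t,\ s\le p_2,\ (k,l)=(s,t),\\[6pt] -\dfrac{\hat\sigma_s\dot r(\hat\sigma_t)-\hat\sigma_t\dot r(\hat\sigma_s)}{\hat\sigma_s^2-\hat\sigma_t^2} & s\ne t,\ s\le p_2,\ (k,l)=(t,s),\\[6pt] \dfrac{\dot r(\hat\sigma_t)}{\hat\sigma_t} & s>p_2,\ (k,l)=(s,t),\\ 0&\text{otherwise,}\end{cases}$$ and put $M=\mathcal X^\top\mathrm{diag}[\{\ddot\ell(\langle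 X_j,\hat B\rangle;y_j)\}_j]\mathcal X+\lambda\mathcal G$ and, when $M$ is nonsingular, $H=\mathcal X M^{-1}\mathcal X^\top$. Then: 1. $R$ is twice continuously differentiable near $\hat B$, and $\mathcal G$ is the matrix of $\nabla^2R(\hat B)$ in the basis $\{\hat u_s\hat v_t^\top\}$: $\nabla^2R(\hat B)[\hat u_s\hat v_t^\top,\hat u_k\hat v_l^\top]=\mathcal G_{kl,st}$. 2. $M$ is nonsingular if and only if the Hessian at $\hat B$ of the full objective is invertible. 3. If $M$ is nonsingular, then for every $i$ the Hessian $\nabla^2F_{/i}(\hat B)$ is invertible if and only if $1-H_{ii}\ddot\ell(\langle X_i,\hat B\rangle;y_i)\ne0$, and in that case $$\langle X_i,\tilde B^{/i}\rangle=\langle X_i,\hat B\rangle+\frac{H_{ii}\,\dot\ell(\langle X_i,\hat B\rangle;y_i)}{1-H_{ii}\,\ddot\ell(\langle X_i,\hat B\rangle;y_i)}.$$ -/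

import Mathlib

open scoped Matrix Topology

-- A norm on real matrices. In finite dimension no derivative below depends on which one is chosen.
attribute [local instance] Matrix.normedAddCommGroup Matrix.normedSpace

namespace ALO

noncomputable section

/-- The inner product `⟨X, B⟩ = trace (Xᵀ B)` of real matrices. -/
def matInner {p₁ p₂ : ℕ} (X B : Matrix (Fin p₁) (Fin p₂) ℝ) : ℝ :=
  (Xᵀ * B).trace

/-- The penalty `R(B) = ∑_{j ≤ min(p₁, p₂)} r(σ_j)`, where `σ_j` is the `j`-th singular value
of `B`. -/
def penalty {p₁ p₂ : ℕ} (r : ℝ → ℝ) (B : Matrix (Fin p₁) (Fin p₂) ℝ) : ℝ :=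
  ∑ j ∈ Finset.range (min p₁ p₂), r ((Matrix.toEuclideanLin B).singularValues j)

/-- The penalized objective `∑_{j ∈ S} ℓ(⟨X_j, B⟩; y_j) + λ R(B)` over the observations in `S`. -/
def objective {n p₁ p₂ : ℕ} (ℓ : ℝ → ℝ → ℝ) (X : Fin n → Matrix (Fin p₁) (Fin p₂) ℝ)
    (y : Fin n → ℝ) (lam : ℝ) (r : ℝ → ℝ) (S : Finset (Fin n))
    (B : Matrix (Fin p₁) (Fin p₂) ℝ) : ℝ :=
  ∑ j ∈ S, ℓ (matInner (X j) B) (y j) + lam * penalty r B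

/-- The Hessian of `F` at `B`, as the linear map sending a direction `Δ` to the differential
at `B` of `DF` along `Δ`, that is, as a bilinear form. -/
def hessian {p₁ p₂ : ℕ} (F : Matrix (Fin p₁) (Fin p₂) ℝ → ℝ) (B : Matrix (Fin p₁) (Fin p₂) ℝ) :
    Matrix (Fin p₁) (Fin p₂) ℝ →L[ℝ] (Matrix (Fin p₁) (Fin p₂) ℝ →L[ℝ] ℝ) :=
  fderiv ℝ (fderiv ℝ F) B

/-- One Newton step from `B` for the minimization of `F`, `B - [∇²F(B)]⁻¹ ∇F(B)`
(meaningful when the Hessian is invertible). -/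
def newtonStep {p₁ p₂ : ℕ} (F : Matrix (Fin p₁) (Fin p₂) ℝ → ℝ) (B : Matrix (Fin p₁) (Fin p₂) ℝ) :
    Matrix (Fin p₁) (Fin p₂) ℝ :=
  B - (hessian F B).inverse (fderiv ℝ F B)

/-- The approximate leave-`i`-out estimator: one Newton step, from the full data estimator `B`,
for the objective without observation `i`. -/
def aloEstimator {n p₁ p₂ : ℕ} (ℓ : ℝ → ℝ → ℝ) (X : Fin n → Matrix (Fin p₁) (Fin p₂) ℝ)
    (y : Fin n → ℝ) (lam : ℝ) (r : ℝ → ℝ) (B : Matrix (Fin p₁) (Fin p₂) ℝ) (i : Fin n) :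
    Matrix (Fin p₁) (Fin p₂) ℝ :=
  newtonStep (objective ℓ X y lam r (Finset.univ.erase i)) B

/-- The `p₁ × p₂` matrix with `σ` on the main diagonal and zeros elsewhere. -/
def rectDiag (p₁ : ℕ) {p₂ : ℕ} (σ : Fin p₂ → ℝ) : Matrix (Fin p₁) (Fin p₂) ℝ :=
  Matrix.of fun s t => if s.val = t.val then σ t else 0

/-- First derivative of the loss in its first argument. -/
def lossD1 (ℓ : ℝ → ℝ → ℝ) (u y : ℝ) : ℝ := deriv (fun v => ℓ v y) u

/-- Second derivative of the loss in its first argument. -/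
def lossD2 (ℓ : ℝ → ℝ → ℝ) (u y : ℝ) : ℝ := deriv (deriv fun v => ℓ v y) u

/-- The `n × p₁p₂` matrix with entries `𝒳_{j,kl} = u_kᵀ X_j v_l`, where `u_k` and `v_l` are the
columns of `U` and `V`. -/
def designX {n p₁ p₂ : ℕ} (X : Fin n → Matrix (Fin p₁) (Fin p₂) ℝ)
    (U : Matrix (Fin p₁) (Fin p₁) ℝ) (V : Matrix (Fin p₂) (Fin p₂) ℝ) :
    Matrix (Fin n) (Fin p₁ × Fin p₂) ℝ :=
  Matrix.of fun j kl => U.col kl.1 ⬝ᵥ (X j *ᵥ V.col kl.2)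

/-- The `p₁p₂ × p₁p₂` matrix `𝒢` of the penalty in the basis `u_k v_lᵀ` (for `p₂ ≤ p₁`); the
index `(k, l)` is `kl` and the index `(s, t)` is `st`. -/
def hessG {p₁ p₂ : ℕ} (r : ℝ → ℝ) (σ : Fin p₂ → ℝ) :
    Matrix (Fin p₁ × Fin p₂) (Fin p₁ × Fin p₂) ℝ :=
  Matrix.of fun kl st =>
    if st.1.val = st.2.val then
      if kl = st then deriv (deriv r) (σ st.2) else 0
    else if hs : st.1.val < p₂ then
      let a := σ ⟨st.1.val, hs⟩
      let b := σ st.2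
      if kl = st then (a * deriv r a - b * deriv r b) / (a ^ 2 - b ^ 2)
      else if kl.1.val = st.2.val ∧ kl.2.val = st.1.val then
        -((a * deriv r b - b * deriv r a) / (a ^ 2 - b ^ 2))
      else 0
    else if kl = st then deriv r (σ st.2) / σ st.2 else 0

/-- The matrix `𝒳ᵀ diag[ℓ̈(⟨X_j, B⟩; y_j)] 𝒳 + λ 𝒢`. -/
def bracket {n p₁ p₂ : ℕ} (ℓ : ℝ → ℝ → ℝ) (X : Fin n → Matrix (Fin p₁) (Fin p₂) ℝ)
    (y : Fin n → ℝ) (lam : ℝ) (r : ℝ → ℝ) (B : Matrix (Fin p₁) (Fin p₂) ℝ)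
    (U : Matrix (Fin p₁) (Fin p₁) ℝ) (σ : Fin p₂ → ℝ) (V : Matrix (Fin p₂) (Fin p₂) ℝ) :
    Matrix (Fin p₁ × Fin p₂) (Fin p₁ × Fin p₂) ℝ :=
  (designX X U V)ᵀ * Matrix.diagonal (fun j => lossD2 ℓ (matInner (X j) B) (y j)) * designX X U V
    + lam • hessG r σ

/-- The matrix `H = 𝒳 [𝒳ᵀ diag[ℓ̈] 𝒳 + λ 𝒢]⁻¹ 𝒳ᵀ`. -/
def hatH {n p₁ p₂ : ℕ} (ℓ : ℝ → ℝ → ℝ) (X : Fin n → Matrix (Fin p₁) (Fin p₂) ℝ)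
    (y : Fin n → ℝ) (lam : ℝ) (r : ℝ → ℝ) (B : Matrix (Fin p₁) (Fin p₂) ℝ)
    (U : Matrix (Fin p₁) (Fin p₁) ℝ) (σ : Fin p₂ → ℝ) (V : Matrix (Fin p₂) (Fin p₂) ℝ) :
    Matrix (Fin n) (Fin n) ℝ :=
  designX X U V * (bracket ℓ X y lam r B U σ V)⁻¹ * (designX X U V)ᵀ

end

end ALO

/-! The penalty is orthogonally invariant, so its derivatives at `B` can be computed at the diagonal
matrix `Σ = rectDiag p₁ σ` and carried back by `Z ↦ U Z Vᵀ`. Near `Σ` each singular value is a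
simple positive root of `det (x² - ZᵀZ)`, so the implicit function theorem makes it C², and with it
the penalty (`contDiffAt_penalty_rectDiag`).

In diagonal directions the Hessian at `Σ` comes from differentiating `∑ r(σ_j)`. In the other
directions invariance replaces a perturbation theory of singular vectors. If `Q(t)`, `W(t)` are
orthogonal curves through `1` with velocities `A`, `C`, differentiating `DR(QZW)[QKW] = DR(Z)[K]`
gives `D²R(Z)[AZ + ZC, K] = -DR(Z)[AK + KC]`. A left and a right rotation in the plane `(s, t)` then
yield two linear equations in `D²R[E_st, K]` and `D²R[E_ts, K]`, of determinant `σ_s² - σ_t²`; their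
solution is `𝒢` (`dirD2_penalty_rectDiag`).

In the coordinates `u_k v_lᵀ` the full Hessian is the bracket matrix `M`, and dropping observation
`i` subtracts `ℓ̈ᵢ xᵢxᵢᵀ`, where `xᵢ` is row `i` of `𝒳`. Stationarity of `B` reduces the
leave-`i`-out gradient to `-ℓ̇ᵢ xᵢ`. The Newton equation is thus a rank one update of `M` whose
right side is a multiple of the same `xᵢ`, and pairing its solution with `xᵢ` leaves one scalar
equation (`rankOne_dotProduct`). -/

namespace ALO

noncomputable section

/-! ### Singular values, invariance and smoothness of the penalty -/

lemma adjoint_comp_toEuclideanLin {p₁ p₂ : ℕ} (Z : Matrix (Fin p₁) (Fin p₂) ℝ) :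
    (Matrix.toEuclideanLin Z).adjoint ∘ₗ Matrix.toEuclideanLin Z
      = Matrix.toEuclideanLin (Zᵀ * Z) := by
  rw [← Matrix.toEuclideanLin_conjTranspose_eq_adjoint, Matrix.conjTranspose_eq_transpose_of_trivial]
  ext v i
  simp [Matrix.mulVec_mulVec]

/-- If `p₂` distinct positive numbers have squares that are eigenvalues of `ZᵀZ`, they are all the
singular values of `Z`. -/
lemma penalty_eq_sum {p₁ p₂ : ℕ} (hp : p₂ ≤ p₁) (r : ℝ → ℝ) (Z : Matrix (Fin p₁) (Fin p₂) ℝ)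
    (μ : Fin p₂ → ℝ) (hμ : ∀ j, 0 < μ j) (hinj : Function.Injective μ)
    (hdet : ∀ j, ((μ j) ^ 2 • (1 : Matrix (Fin p₂) (Fin p₂) ℝ) - Zᵀ * Z).det = 0) :
    penalty r Z = ∑ j, r (μ j) := by
  have hn : Module.finrank ℝ (EuclideanSpace ℝ (Fin p₂)) = p₂ := by simp
  set T := Matrix.toEuclideanLin Z with hT
  have key : ∀ j, ∃ i : Fin p₂, T.singularValues i = μ j := by
    intro j
    obtain ⟨v, hv0, hv⟩ := Matrix.exists_mulVec_eq_zero_iff.mpr (hdet j)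
    have hE : Module.End.HasEigenvalue (T.adjoint ∘ₗ T) ((μ j) ^ 2) := by
      refine Module.End.hasEigenvalue_of_hasEigenvector (x := WithLp.toLp 2 v)
        ⟨Module.End.mem_eigenspace_iff.mpr ?_, by simpa using hv0⟩
      rw [hT, adjoint_comp_toEuclideanLin, Matrix.toLpLin_toLp]
      rw [Matrix.sub_mulVec, Matrix.smul_mulVec, Matrix.one_mulVec, sub_eq_zero] at hv
      rw [Matrix.toLin'_apply, ← hv]
      rfl
    obtain ⟨i, hi⟩ := T.isSymmetric_adjoint_comp_self.exists_eigenvalues_eq hn hE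
    refine ⟨i, ?_⟩
    rw [T.singularValues_fin hn i]
    have hi' : T.isSymmetric_adjoint_comp_self.eigenvalues hn i = (μ j) ^ 2 := by simpa using hi
    rw [hi', Real.sqrt_sq (hμ j).le]
  choose f hf using key
  have hfi : Function.Injective f := fun a b h => hinj (by rw [← hf a, ← hf b, h])
  -- There are exactly `p₂` indices, so distinct values exhaust the singular values and the sum can
  -- be reindexed without knowing their order.
  have hfb : Function.Bijective f := Finite.injective_iff_bijective.mp hfi
  unfold penalty
  rw [min_eq_right hp, ← Fin.sum_univ_eq_sum_range (fun j => r (T.singularValues j))]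
  rw [← hfb.sum_comp (fun i : Fin p₂ => r (T.singularValues i))]
  simp [hf]

/-- Singular values are square roots of the sorted eigenvalues of `ZᵀZ`, and the characteristic
polynomial determines that sorted list. -/
lemma penalty_congr_charpoly {p₁ p₂ : ℕ} (r : ℝ → ℝ) (Z W : Matrix (Fin p₁) (Fin p₂) ℝ)
    (h : (Zᵀ * Z).charpoly = (Wᵀ * W).charpoly) : penalty r Z = penalty r W := by
  have hn : Module.finrank ℝ (EuclideanSpace ℝ (Fin p₂)) = p₂ := by simp
  unfold penalty
  refine Finset.sum_congr rfl fun j hj => ?_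
  have hj' : j < p₂ := lt_of_lt_of_le (Finset.mem_range.mp hj) (min_le_right _ _)
  rw [LinearMap.singularValues_of_lt _ hn hj', LinearMap.singularValues_of_lt _ hn hj',
    (LinearMap.IsSymmetric.eigenvalues_eq_eigenvalues_iff _ hn _ hn).mpr]
  rw [adjoint_comp_toEuclideanLin, adjoint_comp_toEuclideanLin,
    Matrix.toEuclideanLin_eq_toLin_orthonormal, Matrix.charpoly_toLin, Matrix.charpoly_toLin, h]

/-- The penalty is orthogonally invariant. -/
lemma penalty_orthogonal {p₁ p₂ : ℕ} (r : ℝ → ℝ) (Z : Matrix (Fin p₁) (Fin p₂) ℝ)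
    {Q : Matrix (Fin p₁) (Fin p₁) ℝ} {W : Matrix (Fin p₂) (Fin p₂) ℝ}
    (hQ : Qᵀ * Q = 1) (hW : W * Wᵀ = 1) : penalty r (Q * Z * W) = penalty r Z := by
  refine penalty_congr_charpoly r _ _ ?_
  have hW' : Wᵀ * W = 1 := mul_eq_one_comm.mp hW
  have : (Q * Z * W)ᵀ * (Q * Z * W) = Wᵀ * (Zᵀ * Z) * W := by
    calc _ = Wᵀ * (Zᵀ * (Qᵀ * Q) * Z) * W := by simp only [Matrix.transpose_mul, Matrix.mul_assoc]
      _ = _ := by rw [hQ, Matrix.mul_one]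
  rw [this]
  let w : (Matrix (Fin p₂) (Fin p₂) ℝ)ˣ := ⟨Wᵀ, W, hW', hW⟩
  have := Matrix.charpoly_units_conj w (Zᵀ * Z)
  rwa [← Matrix.coe_units_inv] at this

lemma rectDiag_transpose_mul_self {p₁ p₂ : ℕ} (hp : p₂ ≤ p₁) (σ : Fin p₂ → ℝ) :
    (rectDiag p₁ σ)ᵀ * rectDiag p₁ σ = Matrix.diagonal fun j => σ j ^ 2 := by
  ext i j
  rw [Matrix.mul_apply, Finset.sum_eq_single (Fin.castLE hp i)]
  · by_cases h : i = j
    · subst h; simp [rectDiag, sq]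
    · have : i.val ≠ j.val := fun h' => h (Fin.ext h')
      simp [rectDiag, h, this]
  · intro b _ hb
    have : b.val ≠ i.val := fun h => hb (Fin.ext h)
    simp [rectDiag, this]
  · simp

lemma det_smul_one_sub_rectDiag {p₁ p₂ : ℕ} (hp : p₂ ≤ p₁) (σ : Fin p₂ → ℝ) (x : ℝ) :
    (x ^ 2 • (1 : Matrix (Fin p₂) (Fin p₂) ℝ) - (rectDiag p₁ σ)ᵀ * rectDiag p₁ σ).det
      = ∏ i, (x ^ 2 - σ i ^ 2) := by
  rw [rectDiag_transpose_mul_self hp, Matrix.smul_one_eq_diagonal, Matrix.diagonal_sub,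
    Matrix.det_diagonal]

lemma penalty_rectDiag {p₁ p₂ : ℕ} (hp : p₂ ≤ p₁) (r : ℝ → ℝ) (σ : Fin p₂ → ℝ)
    (hσ : ∀ j, 0 < σ j) (hinj : Function.Injective σ) :
    penalty r (rectDiag p₁ σ) = ∑ j, r (σ j) := by
  refine penalty_eq_sum hp r _ σ hσ hinj fun j => ?_
  rw [det_smul_one_sub_rectDiag hp]
  exact Finset.prod_eq_zero (Finset.mem_univ j) (sub_self _)

lemma contDiff_matrix_entry {p₁ p₂ : ℕ} {k : WithTop ℕ∞} (i : Fin p₁) (j : Fin p₂) :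
    ContDiff ℝ k fun Z : Matrix (Fin p₁) (Fin p₂) ℝ => Z i j := by
  have h1 : ContDiff ℝ k fun Z : Fin p₁ → Fin p₂ → ℝ => Z i j := by fun_prop
  exact h1

lemma contDiff_det_smul_one_sub {p₁ p₂ : ℕ} {k : WithTop ℕ∞} :
    ContDiff ℝ k fun w : Matrix (Fin p₁) (Fin p₂) ℝ × ℝ =>
      (w.2 ^ 2 • (1 : Matrix (Fin p₂) (Fin p₂) ℝ) - w.1ᵀ * w.1).det := by
  simp only [Matrix.det_apply, Matrix.sub_apply, Matrix.smul_apply, Matrix.mul_apply,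
    Matrix.transpose_apply]
  have h : ∀ (i : Fin p₁) (j : Fin p₂), ContDiff ℝ k fun w : Matrix (Fin p₁) (Fin p₂) ℝ × ℝ =>
      w.1 i j := fun i j => (contDiff_matrix_entry i j).comp contDiff_fst
  refine ContDiff.sum fun s _ => ContDiff.const_smul _ (contDiff_prod fun i _ => ?_)
  refine ContDiff.sub ?_ (ContDiff.sum fun l _ => (h _ _).mul (h _ _))
  exact (contDiff_snd.pow 2).smul contDiff_const

/-- Each singular value extends to a smooth function near a matrix with distinct nonzero singular
values. -/
lemma exists_smooth_singularValue {p₁ p₂ : ℕ} (hp : p₂ ≤ p₁) (σ : Fin p₂ → ℝ)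
    (hσ : ∀ j, 0 < σ j) (hinj : Function.Injective σ) (j : Fin p₂) :
    ∃ ψ : Matrix (Fin p₁) (Fin p₂) ℝ → ℝ, ContDiffAt ℝ 2 ψ (rectDiag p₁ σ) ∧
      ψ (rectDiag p₁ σ) = σ j ∧
      ∀ᶠ Z in 𝓝 (rectDiag p₁ σ), (ψ Z ^ 2 • (1 : Matrix (Fin p₂) (Fin p₂) ℝ) - Zᵀ * Z).det = 0 := by
  set f : Matrix (Fin p₁) (Fin p₂) ℝ × ℝ → ℝ := fun w =>
    (w.2 ^ 2 • (1 : Matrix (Fin p₂) (Fin p₂) ℝ) - w.1ᵀ * w.1).det with hf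
  set u : Matrix (Fin p₁) (Fin p₂) ℝ × ℝ := (rectDiag p₁ σ, σ j) with hu
  have cdf : ContDiffAt ℝ 2 f u := contDiff_det_smul_one_sub.contDiffAt
  have hfu : f u = 0 := by
    simp only [hf, hu, det_smul_one_sub_rectDiag hp]
    exact Finset.prod_eq_zero (Finset.mem_univ j) (sub_self _)
  -- The root `x = σ j` is simple: by positivity and injectivity of `σ`, the other factors and `2 *
  -- σ j` are nonzero. `hd1` and `hd2` compute the same `x`-derivative, so the partial derivative
  -- required by the implicit function theorem is invertible.
  have hne : (∏ i ∈ Finset.univ.erase j, (σ j ^ 2 - σ i ^ 2)) ≠ 0 := by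
    refine Finset.prod_ne_zero_iff.mpr fun i hi => sub_ne_zero.mpr fun h => ?_
    have := (pow_left_inj₀ (hσ j).le (hσ i).le two_ne_zero).mp h
    exact (Finset.ne_of_mem_erase hi) (hinj this).symm
  have hd1 : HasDerivAt (fun x : ℝ => ∏ i, (x ^ 2 - σ i ^ 2))
      (2 * σ j * ∏ i ∈ Finset.univ.erase j, (σ j ^ 2 - σ i ^ 2)) (σ j) := by
    have e : (fun x : ℝ => ∏ i, (x ^ 2 - σ i ^ 2)) =
        fun x => (x ^ 2 - σ j ^ 2) * ∏ i ∈ Finset.univ.erase j, (x ^ 2 - σ i ^ 2) := by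
      funext x
      exact (Finset.mul_prod_erase Finset.univ (fun i => x ^ 2 - σ i ^ 2) (Finset.mem_univ j)).symm
    rw [e]
    have h1 : HasDerivAt (fun x : ℝ => x ^ 2 - σ j ^ 2) (2 * σ j) (σ j) := by
      simpa using (hasDerivAt_pow 2 (σ j)).sub_const (σ j ^ 2)
    have h2 : DifferentiableAt ℝ
        (fun x : ℝ => ∏ i ∈ Finset.univ.erase j, (x ^ 2 - σ i ^ 2)) (σ j) := by fun_prop
    refine (h1.mul h2.hasDerivAt).congr_deriv ?_
    simp
  have hd2 : HasDerivAt (fun x : ℝ => ∏ i, (x ^ 2 - σ i ^ 2))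
      (fderiv ℝ f u (0, 1)) (σ j) := by
    have e : (fun x : ℝ => ∏ i, (x ^ 2 - σ i ^ 2)) = fun x => f (rectDiag p₁ σ, x) := by
      funext x
      exact (det_smul_one_sub_rectDiag hp σ x).symm
    rw [e]
    exact (cdf.differentiableAt (by norm_num)).hasFDerivAt.comp_hasDerivAt (σ j)
      ((hasDerivAt_const _ _).prodMk (hasDerivAt_id _))
  have hval := hd1.unique hd2
  have if₂ : (fderiv ℝ f u ∘L .inr ℝ (Matrix (Fin p₁) (Fin p₂) ℝ) ℝ).IsInvertible := by
    have h0 : fderiv ℝ f u (0, 1) ≠ 0 := by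
      rw [← hval]
      exact mul_ne_zero (mul_ne_zero two_ne_zero (hσ j).ne') hne
    refine ⟨ContinuousLinearEquiv.unitsEquivAut ℝ (Units.mk0 _ h0), ?_⟩
    ext
    simp
  refine ⟨cdf.implicitFunction two_ne_zero if₂, cdf.contDiffAt_implicitFunction two_ne_zero if₂,
    cdf.implicitFunction_apply_self two_ne_zero if₂, ?_⟩
  filter_upwards [cdf.eventually_apply_implicitFunction two_ne_zero if₂] with Z hZ
  rw [hfu] at hZ
  exact hZ

/-- The root functions `ψ j` stay positive and distinct near the diagonal matrix, hence are all the
singular values there; the penalty is locally `∑ r ∘ ψ j`. -/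
theorem contDiffAt_penalty_rectDiag {p₁ p₂ : ℕ} (hp : p₂ ≤ p₁) (r : ℝ → ℝ)
    (hr : ContDiffOn ℝ 2 r (Set.Ioi 0)) (σ : Fin p₂ → ℝ)
    (hσ : ∀ j, 0 < σ j) (hinj : Function.Injective σ) :
    ContDiffAt ℝ 2 (penalty r) (rectDiag p₁ σ) := by
  choose ψ hψ hψσ hdet using exists_smooth_singularValue hp σ hσ hinj
  have hpos : ∀ᶠ Z in 𝓝 (rectDiag p₁ σ), ∀ j, 0 < ψ j Z :=
    Filter.eventually_all.mpr fun j =>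
      (hψ j).continuousAt.eventually (lt_mem_nhds (by rw [hψσ]; exact hσ j))
  have hdist : ∀ᶠ Z in 𝓝 (rectDiag p₁ σ), ∀ i j, i ≠ j → ψ i Z ≠ ψ j Z := by
    refine Filter.eventually_all.mpr fun i => Filter.eventually_all.mpr fun j => ?_
    by_cases h : i = j
    · simp [h]
    · have := ((hψ i).continuousAt.ne_iff_eventually_ne (hψ j).continuousAt).mp
        (by rw [hψσ, hψσ]; exact fun h' => h (hinj h'))
      filter_upwards [this] with Z hZ _ using hZ
  have heq : penalty r =ᶠ[𝓝 (rectDiag p₁ σ)] fun Z => ∑ j, r (ψ j Z) := by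
    filter_upwards [hpos, hdist, Filter.eventually_all.mpr hdet] with Z h1 h2 h3
    exact penalty_eq_sum hp r Z (fun j => ψ j Z) h1
      (fun i j h => by_contra fun hij => h2 i j hij h) h3
  refine ContDiffAt.congr_of_eventuallyEq ?_ heq
  refine ContDiffAt.sum fun j _ => ContDiffAt.comp _ ?_ (hψ j)
  rw [hψσ]
  exact hr.contDiffAt (Ioi_mem_nhds (hσ j))

/-! ### Directional derivatives along curves and under linear symmetries -/

section Normed

variable {E : Type*} [NormedAddCommGroup E] [NormedSpace ℝ E]

/-- The directional derivative `Df(x)[v]`. -/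
def dirD1 (f : E → ℝ) (x v : E) : ℝ := fderiv ℝ f x v

/-- The second directional derivative `D²f(x)[v, w]`. -/
def dirD2 (f : E → ℝ) (x v w : E) : ℝ := fderiv ℝ (fderiv ℝ f) x v w

/-- The curve `γ` has velocity `v` at time `0`. -/
def IsVelocity (γ : ℝ → E) (v : E) : Prop := HasDerivAt γ v 0

lemma dirD1_sub (f : E → ℝ) (x v w : E) : dirD1 f x (v - w) = dirD1 f x v - dirD1 f x w :=
  map_sub _ v w

lemma dirD1_smul (f : E → ℝ) (x : E) (c : ℝ) (v : E) : dirD1 f x (c • v) = c * dirD1 f x v :=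
  map_smul _ c v

lemma dirD2_sub (f : E → ℝ) (x v v' w : E) :
    dirD2 f x (v - v') w = dirD2 f x v w - dirD2 f x v' w := by
  simp [dirD2]

lemma dirD2_smul (f : E → ℝ) (x : E) (c : ℝ) (v w : E) :
    dirD2 f x (c • v) w = c * dirD2 f x v w := by
  simp [dirD2]

lemma differentiableAt_fderiv_of_contDiffAt_two {f : E → ℝ} {x : E} (h : ContDiffAt ℝ 2 f x) :
    DifferentiableAt ℝ (fderiv ℝ f) x :=
  (h.fderiv_right (m := 1) (by norm_num)).differentiableAt (by norm_num)

lemma dirD1_eq_of_curve {f : E → ℝ} {x v : E} {γ : ℝ → E} {c : ℝ} (hf : ContDiffAt ℝ 2 f x)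
    (hγ : IsVelocity γ v) (h0 : γ 0 = x) (h : HasDerivAt (fun t => f (γ t)) c 0) :
    dirD1 f x v = c := by
  subst h0
  exact ((hf.differentiableAt (by norm_num)).hasFDerivAt.comp_hasDerivAt 0 hγ).unique h

/-- The product rule when both the base point `γ` and the direction `κ` move; the second term comes
from the velocity of `κ`. -/
lemma dirD2_eq_of_curve {f : E → ℝ} {x v w k : E} {γ κ : ℝ → E} {c : ℝ} (hf : ContDiffAt ℝ 2 f x)
    (hγ : IsVelocity γ v) (h0 : γ 0 = x) (hκ : IsVelocity κ w) (h0' : κ 0 = k)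
    (h : HasDerivAt (fun t => dirD1 f (γ t) (κ t)) c 0) :
    dirD2 f x v k + dirD1 f x w = c := by
  subst h0 h0'
  exact (((differentiableAt_fderiv_of_contDiffAt_two hf).hasFDerivAt.comp_hasDerivAt 0
    hγ).clm_apply hκ).unique h

lemma isVelocity_const (x : E) : IsVelocity (fun _ => x) 0 := hasDerivAt_const _ _

lemma isVelocity_line (x v : E) : IsVelocity (fun t => x + t • v) v := by
  have h := ((hasDerivAt_id (0 : ℝ)).smul_const v).const_add x
  rw [one_smul] at h
  exact h

lemma hasDerivAt_linear_line (ψ : E →ₗ[ℝ] ℝ) (x v : E) :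
    HasDerivAt (fun t : ℝ => ψ (x + t • v)) (ψ v) 0 := by
  have h := ((hasDerivAt_id (0 : ℝ)).mul_const (ψ v)).const_add (ψ x)
  rw [one_mul] at h
  simpa using! h

lemma hasDerivAt_dirD1_line {f : E → ℝ} {x : E} (hf : ContDiffAt ℝ 2 f x) (v w : E) :
    HasDerivAt (fun t : ℝ => dirD1 f (x + t • v) w) (dirD2 f x v w) 0 := by
  have h1 := (differentiableAt_fderiv_of_contDiffAt_two hf).hasFDerivAt.clm_apply
    (hasFDerivAt_const w x)
  have h3 := HasFDerivAt.comp_hasDerivAt_of_eq (0 : ℝ) h1 (isVelocity_line x v) (by simp)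
  simpa [dirD2] using! h3

variable [FiniteDimensional ℝ E] {f : E → ℝ} (L : E ≃ₗ[ℝ] E)

lemma dirD1_linearEquiv (hL : ∀ x, f (L x) = f x) (x v : E) :
    dirD1 f (L x) (L v) = dirD1 f x v := by
  have h := L.toContinuousLinearEquiv.comp_right_fderiv (f := f) (x := x)
  rw [show f ∘ L.toContinuousLinearEquiv = f from funext hL] at h
  unfold dirD1
  rw [h]
  rfl

lemma contDiffAt_linearEquiv (hL : ∀ x, f (L x) = f x) {x : E} (h : ContDiffAt ℝ 2 f x) :
    ContDiffAt ℝ 2 f (L x) := by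
  have e : f = f ∘ L.toContinuousLinearEquiv.symm := funext fun y => by
    rw [Function.comp_apply, ← hL (L.toContinuousLinearEquiv.symm y)]
    exact congrArg f (L.apply_symm_apply y).symm
  rw [e]
  refine ContDiffAt.comp _ ?_ L.toContinuousLinearEquiv.symm.contDiff.contDiffAt
  have : L.toContinuousLinearEquiv.symm (L x) = x := L.symm_apply_apply x
  rwa [this]

lemma dirD2_linearEquiv (hL : ∀ x, f (L x) = f x) {x : E} (h : ContDiffAt ℝ 2 f x) (v w : E) :
    dirD2 f (L x) (L v) (L w) = dirD2 f x v w := by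
  have hγ : IsVelocity (fun t : ℝ => L (x + t • v)) (L v) := by
    simpa only [map_add, map_smul] using isVelocity_line (L x) (L v)
  have h4 : HasDerivAt (fun t : ℝ => dirD1 f (L (x + t • v)) (L w)) (dirD2 f x v w) 0 := by
    simpa only [dirD1_linearEquiv L hL] using hasDerivAt_dirD1_line h v w
  have h5 := dirD2_eq_of_curve (contDiffAt_linearEquiv L hL h) hγ (by simp)
    (isVelocity_const (L w)) rfl h4
  rwa [dirD1, map_zero, add_zero] at h5

end Normed

/-! ### Plane rotations and the identities forced by invariance -/

lemma isVelocity_matrix {m n : Type*} [Fintype m] [Fintype n] {f : ℝ → Matrix m n ℝ}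
    {f' : Matrix m n ℝ} : IsVelocity f f' ↔ ∀ i j, HasDerivAt (fun s => f s i j) (f' i j) 0 := by
  have h1 : IsVelocity f f' ↔ ∀ i, HasDerivAt (fun s => f s i) (f' i) 0 :=
    hasDerivAt_pi (φ := f) (φ' := f')
  exact h1.trans (forall_congr' fun i => hasDerivAt_pi)

lemma IsVelocity.matrix_mul {l m n : Type*} [Fintype l] [Fintype m] [Fintype n]
    {f : ℝ → Matrix l m ℝ} {f' : Matrix l m ℝ} {g : ℝ → Matrix m n ℝ} {g' : Matrix m n ℝ}
    (hf : IsVelocity f f') (hg : IsVelocity g g') :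
    IsVelocity (fun s => f s * g s) (f' * g 0 + f 0 * g') := by
  rw [isVelocity_matrix] at *
  intro i j
  simp only [Matrix.mul_apply, Matrix.add_apply, ← Finset.sum_add_distrib]
  exact HasDerivAt.fun_sum fun k _ => (hf i k).mul (hg k j)

/-- A plane rotation by the angle `t`, generated by a skew matrix with `A³ = -A`. -/
def rotation {m : Type*} [Fintype m] [DecidableEq m] (A : Matrix m m ℝ) (t : ℝ) : Matrix m m ℝ :=
  1 + Real.sin t • A + (1 - Real.cos t) • (A * A)

lemma rotation_zero {m : Type*} [Fintype m] [DecidableEq m] (A : Matrix m m ℝ) :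
    rotation A 0 = 1 := by simp [rotation]

/-- With `A³ = -A`, all powers of `A` in the product reduce to `A` and `A²`, and the coefficient of
`A²` vanishes by `sin² + cos² = 1`. -/
lemma rotation_transpose_mul_self {m : Type*} [Fintype m] [DecidableEq m] {A : Matrix m m ℝ}
    (hA : Aᵀ = -A) (hA3 : A * (A * A) = -A) (t : ℝ) : (rotation A t)ᵀ * rotation A t = 1 := by
  simp only [rotation, Matrix.transpose_add, Matrix.transpose_smul, Matrix.transpose_mul, hA,
    Matrix.transpose_one, Matrix.mul_add, Matrix.add_mul, Matrix.smul_mul, Matrix.mul_smul,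
    Matrix.neg_mul, Matrix.mul_neg, Matrix.one_mul, Matrix.mul_one, neg_neg, Matrix.mul_assoc,
    hA3]
  have : Real.sin t ^ 2 = 1 - Real.cos t ^ 2 := Real.sin_sq t
  match_scalars <;> first | ring1 | linear_combination this | linear_combination -this

lemma isVelocity_rotation {m : Type*} [Fintype m] [DecidableEq m] (A : Matrix m m ℝ) :
    IsVelocity (rotation A) A := by
  refine isVelocity_matrix.mpr fun i j => ?_
  have h1 := (Real.hasDerivAt_sin 0).mul_const (A i j)
  have h2 := ((Real.hasDerivAt_cos 0).const_sub 1).mul_const ((A * A) i j)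
  have h3 := (h1.const_add ((1 : Matrix m m ℝ) i j)).add h2
  simp only [Real.cos_zero, Real.sin_zero, neg_zero, one_mul, zero_mul, add_zero] at h3
  exact h3

/-- The linear equivalence `Z ↦ Q Z W` for orthogonal `Q` and `W`. -/
def orthoEquiv {p₁ p₂ : ℕ} (Q : Matrix (Fin p₁) (Fin p₁) ℝ) (W : Matrix (Fin p₂) (Fin p₂) ℝ)
    (hQ : Qᵀ * Q = 1) (hW : W * Wᵀ = 1) :
    Matrix (Fin p₁) (Fin p₂) ℝ ≃ₗ[ℝ] Matrix (Fin p₁) (Fin p₂) ℝ where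
  toFun Z := Q * Z * W
  map_add' Z Y := by rw [Matrix.mul_add, Matrix.add_mul]
  map_smul' c Z := by simp
  invFun Z := Qᵀ * Z * Wᵀ
  left_inv Z := by
    change Qᵀ * (Q * Z * W) * Wᵀ = Z
    rw [show Qᵀ * (Q * Z * W) * Wᵀ = (Qᵀ * Q) * Z * (W * Wᵀ) by simp only [Matrix.mul_assoc],
      hQ, hW, Matrix.one_mul, Matrix.mul_one]
  right_inv Z := by
    change Q * (Qᵀ * Z * Wᵀ) * W = Z
    rw [show Q * (Qᵀ * Z * Wᵀ) * W = (Q * Qᵀ) * Z * (Wᵀ * W) by simp only [Matrix.mul_assoc],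
      mul_eq_one_comm.mp hQ, mul_eq_one_comm.mp hW, Matrix.one_mul, Matrix.mul_one]

lemma orthoEquiv_apply {p₁ p₂ : ℕ} {Q : Matrix (Fin p₁) (Fin p₁) ℝ} {W : Matrix (Fin p₂) (Fin p₂) ℝ}
    (hQ : Qᵀ * Q = 1) (hW : W * Wᵀ = 1) (Z : Matrix (Fin p₁) (Fin p₂) ℝ) :
    orthoEquiv Q W hQ hW Z = Q * Z * W := rfl

section Curves

variable {p₁ p₂ : ℕ} {r : ℝ → ℝ} {Z : Matrix (Fin p₁) (Fin p₂) ℝ}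
  {Q : ℝ → Matrix (Fin p₁) (Fin p₁) ℝ} {W : ℝ → Matrix (Fin p₂) (Fin p₂) ℝ}
  {A : Matrix (Fin p₁) (Fin p₁) ℝ} {C : Matrix (Fin p₂) (Fin p₂) ℝ}

lemma isVelocity_mul_mul (hQd : IsVelocity Q A) (hQ0 : Q 0 = 1) (hWd : IsVelocity W C)
    (hW0 : W 0 = 1) (K : Matrix (Fin p₁) (Fin p₂) ℝ) :
    IsVelocity (fun t => Q t * K * W t) (A * K + K * C) := by
  have := (hQd.matrix_mul (isVelocity_const K)).matrix_mul hWd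
  simpa [hQ0, hW0] using this

lemma dirD1_penalty_rotate (hZ : ContDiffAt ℝ 2 (penalty r) Z)
    (hQd : IsVelocity Q A) (hQ0 : Q 0 = 1) (hQ : ∀ t, (Q t)ᵀ * Q t = 1)
    (hWd : IsVelocity W C) (hW0 : W 0 = 1) (hW : ∀ t, W t * (W t)ᵀ = 1) :
    dirD1 (penalty r) Z (A * Z + Z * C) = 0 := by
  refine dirD1_eq_of_curve hZ (isVelocity_mul_mul hQd hQ0 hWd hW0 Z) (by simp [hQ0, hW0]) ?_
  simp only [penalty_orthogonal r Z (hQ _) (hW _)]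
  exact hasDerivAt_const _ _

/-- Invariance makes `DR(QZW)[QKW]` constant in `t`; its derivative at `0` is the sum of a
second-order term and a first-order term, so the Hessian is read off from the gradient. -/
lemma dirD2_penalty_rotate (hZ : ContDiffAt ℝ 2 (penalty r) Z)
    (hQd : IsVelocity Q A) (hQ0 : Q 0 = 1) (hQ : ∀ t, (Q t)ᵀ * Q t = 1)
    (hWd : IsVelocity W C) (hW0 : W 0 = 1) (hW : ∀ t, W t * (W t)ᵀ = 1)
    (K : Matrix (Fin p₁) (Fin p₂) ℝ) :
    dirD2 (penalty r) Z (A * Z + Z * C) K = - dirD1 (penalty r) Z (A * K + K * C) := by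
  refine eq_neg_of_add_eq_zero_left ?_
  refine dirD2_eq_of_curve hZ (isVelocity_mul_mul hQd hQ0 hWd hW0 Z) (by simp [hQ0, hW0])
    (isVelocity_mul_mul hQd hQ0 hWd hW0 K) (by simp [hQ0, hW0]) ?_
  have e : ∀ t, dirD1 (penalty r) (Q t * Z * W t) (Q t * K * W t) = dirD1 (penalty r) Z K :=
    fun t => dirD1_linearEquiv (orthoEquiv (Q t) (W t) (hQ t) (hW t))
      (fun Y => penalty_orthogonal r Y (hQ t) (hW t)) Z K
  simp only [e]
  exact hasDerivAt_const _ _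

end Curves

/-- The generator `e_s e_tᵀ - e_t e_sᵀ` of a plane rotation. -/
def planeSkew {m : Type*} [DecidableEq m] (s t : m) : Matrix m m ℝ :=
  Matrix.single s t 1 - Matrix.single t s 1

lemma planeSkew_transpose {m : Type*} [DecidableEq m] (s t : m) :
    (planeSkew s t)ᵀ = -planeSkew s t := by
  simp [planeSkew]

lemma planeSkew_cube {m : Type*} [Fintype m] [DecidableEq m] {s t : m} (h : s ≠ t) :
    planeSkew s t * (planeSkew s t * planeSkew s t) = -planeSkew s t := by
  simp [planeSkew, Matrix.mul_sub, Matrix.sub_mul, h, h.symm]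
  abel

section Rotate

variable {p₁ p₂ : ℕ} {r : ℝ → ℝ} {Z : Matrix (Fin p₁) (Fin p₂) ℝ}

lemma planeRotation_spec {m : Type*} [Fintype m] [DecidableEq m] {s t : m} (h : s ≠ t) :
    IsVelocity (rotation (planeSkew s t)) (planeSkew s t) ∧ rotation (planeSkew s t) 0 = 1 ∧
    (∀ x, (rotation (planeSkew s t) x)ᵀ * rotation (planeSkew s t) x = 1) ∧
    (∀ x, rotation (planeSkew s t) x * (rotation (planeSkew s t) x)ᵀ = 1) := by
  have h1 := rotation_transpose_mul_self (planeSkew_transpose s t) (planeSkew_cube h)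
  exact ⟨isVelocity_rotation _, rotation_zero _, h1, fun x => mul_eq_one_comm.mp (h1 x)⟩

lemma dirD1_penalty_planeSkew_mul (hZ : ContDiffAt ℝ 2 (penalty r) Z) {s t : Fin p₁}
    (h : s ≠ t) : dirD1 (penalty r) Z (planeSkew s t * Z) = 0 := by
  obtain ⟨h1, h2, h3, -⟩ := planeRotation_spec h
  simpa using dirD1_penalty_rotate hZ h1 h2 h3 (isVelocity_const 1) rfl (by simp)

lemma dirD1_penalty_mul_planeSkew (hZ : ContDiffAt ℝ 2 (penalty r) Z) {s t : Fin p₂}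
    (h : s ≠ t) : dirD1 (penalty r) Z (Z * planeSkew s t) = 0 := by
  obtain ⟨h1, h2, -, h3⟩ := planeRotation_spec h
  simpa using dirD1_penalty_rotate hZ (isVelocity_const 1) rfl (by simp) h1 h2 h3

lemma dirD2_penalty_planeSkew_mul (hZ : ContDiffAt ℝ 2 (penalty r) Z) {s t : Fin p₁}
    (h : s ≠ t) (K : Matrix (Fin p₁) (Fin p₂) ℝ) :
    dirD2 (penalty r) Z (planeSkew s t * Z) K = -dirD1 (penalty r) Z (planeSkew s t * K) := by
  obtain ⟨h1, h2, h3, -⟩ := planeRotation_spec h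
  simpa using dirD2_penalty_rotate hZ h1 h2 h3 (isVelocity_const 1) rfl (by simp) K

lemma dirD2_penalty_mul_planeSkew (hZ : ContDiffAt ℝ 2 (penalty r) Z) {s t : Fin p₂}
    (h : s ≠ t) (K : Matrix (Fin p₁) (Fin p₂) ℝ) :
    dirD2 (penalty r) Z (Z * planeSkew s t) K = -dirD1 (penalty r) Z (K * planeSkew s t) := by
  obtain ⟨h1, h2, -, h3⟩ := planeRotation_spec h
  simpa using dirD2_penalty_rotate hZ (isVelocity_const 1) rfl (by simp) h1 h2 h3 K

end Rotate

/-! ### Gradient and Hessian of the penalty at a diagonal matrix -/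

section RectDiag

variable {p₁ p₂ : ℕ}

lemma single_mul_rectDiag_of_eq (σ : Fin p₂ → ℝ) (i k : Fin p₁) {j : Fin p₂}
    (h : k.val = j.val) :
    Matrix.single i k (1 : ℝ) * rectDiag p₁ σ = σ j • Matrix.single i j (1 : ℝ) := by
  ext a b
  by_cases ha : a = i
  · subst ha
    by_cases hb : b = j
    · subst hb; simp [rectDiag, h]
    · have : j.val ≠ b.val := fun h' => hb (Fin.ext h'.symm)
      simp [rectDiag, h, this, Ne.symm hb]
  · simp [Matrix.single_mul_apply_of_ne, ha, Ne.symm ha]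

lemma single_mul_rectDiag_of_le (σ : Fin p₂ → ℝ) (i k : Fin p₁) (h : p₂ ≤ k.val) :
    Matrix.single i k (1 : ℝ) * rectDiag p₁ σ = 0 := by
  ext a b
  by_cases ha : a = i
  · subst ha
    have : k.val ≠ b.val := (b.isLt.trans_le h).ne'
    simp [rectDiag, this]
  · simp [Matrix.single_mul_apply_of_ne, ha]

lemma rectDiag_mul_single (σ : Fin p₂ → ℝ) (j : Fin p₂) (i : Fin p₂) {k : Fin p₁}
    (h : k.val = i.val) :
    rectDiag p₁ σ * Matrix.single i j (1 : ℝ) = σ i • Matrix.single k j (1 : ℝ) := by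
  ext a b
  by_cases hb : b = j
  · subst hb
    by_cases ha : a = k
    · subst ha; simp [rectDiag, h]
    · have : a.val ≠ i.val := fun h' => ha (Fin.ext (h'.trans h.symm))
      simp [rectDiag, this, Ne.symm ha]
  · simp [Matrix.mul_single_apply_of_ne, hb, Ne.symm hb]

lemma rectDiag_add_smul_single (σ : Fin p₂ → ℝ) (τ : ℝ) {k : Fin p₁} {t : Fin p₂}
    (h : k.val = t.val) :
    rectDiag p₁ (σ + τ • Pi.single t 1) = rectDiag p₁ σ + τ • Matrix.single k t 1 := by
  ext a b
  by_cases hb : b = t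
  · subst hb
    by_cases ha : a = k
    · subst ha; simp [rectDiag, h]
    · have : a.val ≠ b.val := fun h' => ha (Fin.ext (h'.trans h.symm))
      simp [rectDiag, this, Ne.symm ha]
  · simp [rectDiag, hb, Ne.symm hb]

lemma eventually_pos_injective {σ : Fin p₂ → ℝ} (hσ : ∀ j, 0 < σ j)
    (hinj : Function.Injective σ) :
    ∀ᶠ σ' in 𝓝 σ, (∀ j, 0 < σ' j) ∧ Function.Injective σ' := by
  have hc : ∀ j, ContinuousAt (fun σ' : Fin p₂ → ℝ => σ' j) σ :=
    fun j => (continuous_apply j).continuousAt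
  have h1 : ∀ᶠ σ' in 𝓝 σ, ∀ j, 0 < σ' j :=
    Filter.eventually_all.mpr fun j => (hc j).eventually (lt_mem_nhds (hσ j))
  have h2 : ∀ᶠ σ' in 𝓝 σ, ∀ i j, i ≠ j → σ' i ≠ σ' j := by
    refine Filter.eventually_all.mpr fun i => Filter.eventually_all.mpr fun j => ?_
    by_cases h : i = j
    · simp [h]
    · filter_upwards [((hc i).ne_iff_eventually_ne (hc j)).mp fun h' => h (hinj h')] with Z hZ _
        using hZ
  filter_upwards [h1, h2] with σ' h1 h2
  exact ⟨h1, fun i j h => by_contra fun hij => h2 i j hij h⟩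

lemma eventually_pos_injective_line {σ : Fin p₂ → ℝ} (hσ : ∀ j, 0 < σ j)
    (hinj : Function.Injective σ) (d : Fin p₂ → ℝ) :
    ∀ᶠ τ : ℝ in 𝓝 0, (∀ j, 0 < (σ + τ • d) j) ∧ Function.Injective (σ + τ • d) := by
  have hc : ContinuousAt (fun τ : ℝ => σ + τ • d) 0 := by fun_prop
  have h := eventually_pos_injective hσ hinj
  rw [show σ = σ + (0 : ℝ) • d by simp] at h
  exact hc.eventually h

variable {r : ℝ → ℝ} {σ : Fin p₂ → ℝ}

lemma hasDerivAt_add_smul_single_apply (t j : Fin p₂) :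
    HasDerivAt (fun τ : ℝ => (σ + τ • (Pi.single t 1 : Fin p₂ → ℝ)) j)
      ((Pi.single t 1 : Fin p₂ → ℝ) j) 0 := by
  have h := ((hasDerivAt_id (0 : ℝ)).mul_const ((Pi.single t 1 : Fin p₂ → ℝ) j)).const_add (σ j)
  rw [one_mul] at h
  exact h

/-- A small move in this direction keeps the matrix diagonal with positive distinct entries, where
the penalty is `∑ r`. -/
lemma dirD1_penalty_diag (hp : p₂ ≤ p₁) (hr : ContDiffOn ℝ 2 r (Set.Ioi 0))
    (hσ : ∀ j, 0 < σ j) (hinj : Function.Injective σ) {k : Fin p₁} {t : Fin p₂}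
    (h : k.val = t.val) :
    dirD1 (penalty r) (rectDiag p₁ σ) (Matrix.single k t 1) = deriv r (σ t) := by
  have hS := contDiffAt_penalty_rectDiag hp r hr σ hσ hinj
  have hrd : ∀ j, HasDerivAt r (deriv r (σ j)) (σ j) := fun j =>
    ((hr.contDiffAt (Ioi_mem_nhds (hσ j))).differentiableAt (by norm_num)).hasDerivAt
  have h2 : HasDerivAt (fun τ : ℝ => ∑ j, r ((σ + τ • (Pi.single t 1 : Fin p₂ → ℝ)) j))
      (∑ j, deriv r (σ j) * (Pi.single t 1 : Fin p₂ → ℝ) j) 0 := by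
    refine HasDerivAt.fun_sum fun j _ => ?_
    have hrj : HasDerivAt r (deriv r (σ j)) ((σ + (0 : ℝ) • (Pi.single t 1 : Fin p₂ → ℝ)) j) := by
      simpa using hrd j
    exact hrj.comp 0 (hasDerivAt_add_smul_single_apply t j)
  have e : (fun τ : ℝ => penalty r (rectDiag p₁ σ + τ • Matrix.single k t 1)) =ᶠ[𝓝 0]
      fun τ : ℝ => ∑ j, r ((σ + τ • (Pi.single t 1 : Fin p₂ → ℝ)) j) := by
    filter_upwards [eventually_pos_injective_line hσ hinj (Pi.single t 1)] with τ hτ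
    rw [← rectDiag_add_smul_single σ τ h]
    exact penalty_rectDiag hp r _ hτ.1 hτ.2
  rw [dirD1_eq_of_curve hS (isVelocity_line _ _) (by simp) (h2.congr_of_eventuallyEq e),
    Finset.sum_eq_single t]
  · simp
  · intro b _ hb; simp [hb]
  · simp

lemma dirD1_penalty_offDiag (hp : p₂ ≤ p₁) (hr : ContDiffOn ℝ 2 r (Set.Ioi 0))
    (hσ : ∀ j, 0 < σ j) (hinj : Function.Injective σ) {s : Fin p₁} {t : Fin p₂}
    (h : s.val ≠ t.val) :
    dirD1 (penalty r) (rectDiag p₁ σ) (Matrix.single s t 1) = 0 := by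
  have hS := contDiffAt_penalty_rectDiag hp r hr σ hσ hinj
  have hne : s ≠ Fin.castLE hp t := fun h' => h (by rw [h']; rfl)
  have hL := dirD1_penalty_planeSkew_mul hS hne
  rw [planeSkew, Matrix.sub_mul, single_mul_rectDiag_of_eq σ s (Fin.castLE hp t) (j := t) rfl] at hL
  by_cases hs : s.val < p₂
  · rw [single_mul_rectDiag_of_eq σ _ s (j := ⟨s, hs⟩) rfl] at hL
    have hne' : (⟨s, hs⟩ : Fin p₂) ≠ t := fun h' => h (congrArg Fin.val h')
    have hR := dirD1_penalty_mul_planeSkew hS hne'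
    rw [planeSkew, Matrix.mul_sub, rectDiag_mul_single σ t ⟨s, hs⟩ (k := s) rfl,
      rectDiag_mul_single σ ⟨s, hs⟩ t (k := Fin.castLE hp t) rfl] at hR
    simp only [dirD1_sub, dirD1_smul] at hL hR
    have hsq : σ ⟨s, hs⟩ ^ 2 - σ t ^ 2 ≠ 0 := sub_ne_zero.mpr fun h' =>
      hne' (hinj ((pow_left_inj₀ (hσ _).le (hσ _).le two_ne_zero).mp h'))
    refine (mul_eq_zero.mp ?_).resolve_left hsq
    -- With `a = DR[E_st]` and `b = DR[E_ts]`, `hL` is `σ_t a - σ_s b = 0` and `hR` is `σ_s a - σ_t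
    -- b = 0`; this combination eliminates `b`.
    linear_combination σ ⟨s, hs⟩ * hR - σ t * hL
  · rw [single_mul_rectDiag_of_le σ _ s (not_lt.mp hs)] at hL
    simp only [sub_zero, dirD1_smul] at hL
    exact (mul_eq_zero.mp hL).resolve_left (hσ t).ne'

lemma dirD1_penalty_single (hp : p₂ ≤ p₁) (hr : ContDiffOn ℝ 2 r (Set.Ioi 0))
    (hσ : ∀ j, 0 < σ j) (hinj : Function.Injective σ) (s : Fin p₁) (t : Fin p₂) :
    dirD1 (penalty r) (rectDiag p₁ σ) (Matrix.single s t 1)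
      = if s.val = t.val then deriv r (σ t) else 0 := by
  split_ifs with h
  · exact dirD1_penalty_diag hp hr hσ hinj h
  · exact dirD1_penalty_offDiag hp hr hσ hinj h

lemma hasDerivAt_deriv_of_contDiffAt {f : ℝ → ℝ} {x : ℝ} (h : ContDiffAt ℝ 2 f x) :
    HasDerivAt (deriv f) (deriv (deriv f) x) x := by
  have h1 := differentiableAt_fderiv_of_contDiffAt_two h
  have h2 : DifferentiableAt ℝ (fun z => fderiv ℝ f z 1) x :=
    h1.clm_apply (differentiableAt_const _)
  simp only [fderiv_apply_one_eq_deriv] at h2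
  exact h2.hasDerivAt

/-- The perturbed matrix stays diagonal, so the gradient formula `dirD1_penalty_single` holds along
the whole short line and can be differentiated. -/
lemma dirD2_penalty_diag (hp : p₂ ≤ p₁) (hr : ContDiffOn ℝ 2 r (Set.Ioi 0))
    (hσ : ∀ j, 0 < σ j) (hinj : Function.Injective σ) {s : Fin p₁} {t : Fin p₂}
    (h : s.val = t.val) (k : Fin p₁) (l : Fin p₂) :
    dirD2 (penalty r) (rectDiag p₁ σ) (Matrix.single s t 1) (Matrix.single k l 1)
      = if k = s ∧ l = t then deriv (deriv r) (σ t) else 0 := by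
  have hS := contDiffAt_penalty_rectDiag hp r hr σ hσ hinj
  have h2 : HasDerivAt (fun τ : ℝ => if k.val = l.val then
      deriv r ((σ + τ • (Pi.single t 1 : Fin p₂ → ℝ)) l) else 0)
      (if k = s ∧ l = t then deriv (deriv r) (σ t) else 0) 0 := by
    by_cases hkl : k.val = l.val
    · simp only [hkl, if_true]
      have hrl : HasDerivAt (deriv r) (deriv (deriv r) (σ l))
          ((σ + (0 : ℝ) • (Pi.single t 1 : Fin p₂ → ℝ)) l) := by
        simpa using hasDerivAt_deriv_of_contDiffAt (hr.contDiffAt (Ioi_mem_nhds (hσ l)))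
      refine (hrl.comp 0 (hasDerivAt_add_smul_single_apply t l)).congr_deriv ?_
      by_cases hlt : l = t
      · subst hlt
        simp [Fin.ext (hkl.trans h.symm)]
      · simp [hlt]
    · have : ¬ (k = s ∧ l = t) := fun ⟨a, b⟩ => hkl (by rw [a, b, h])
      simp only [hkl, this, if_false]
      exact hasDerivAt_const _ _
  have e : (fun τ : ℝ => dirD1 (penalty r) (rectDiag p₁ σ + τ • Matrix.single s t 1)
      (Matrix.single k l 1)) =ᶠ[𝓝 0] fun τ : ℝ => if k.val = l.val then
      deriv r ((σ + τ • (Pi.single t 1 : Fin p₂ → ℝ)) l) else 0 := by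
    filter_upwards [eventually_pos_injective_line hσ hinj (Pi.single t 1)] with τ hτ
    rw [← rectDiag_add_smul_single σ τ h]
    exact dirD1_penalty_single hp hr hτ.1 hτ.2 k l
  have h3 := dirD2_eq_of_curve hS (isVelocity_line _ _) (by simp)
    (isVelocity_const (Matrix.single k l (1 : ℝ))) rfl (h2.congr_of_eventuallyEq e)
  rwa [dirD1, map_zero, add_zero] at h3

lemma single_mul_single_eq_ite {l m n : Type*} [Fintype m] [DecidableEq l] [DecidableEq m]
    [DecidableEq n] (i : l) (j k : m) (q : n) :
    Matrix.single i j (1 : ℝ) * Matrix.single k q (1 : ℝ)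
      = (if j = k then (1 : ℝ) else 0) • Matrix.single i q (1 : ℝ) := by
  split_ifs with h
  · subst h; simp
  · simp [h]

lemma dirD1_penalty_planeSkew_mul_single (hp : p₂ ≤ p₁) (hr : ContDiffOn ℝ 2 r (Set.Ioi 0))
    (hσ : ∀ j, 0 < σ j) (hinj : Function.Injective σ) (s t k : Fin p₁) (l : Fin p₂) :
    dirD1 (penalty r) (rectDiag p₁ σ) (planeSkew s t * Matrix.single k l (1 : ℝ))
      = (if t = k ∧ s.val = l.val then deriv r (σ l) else 0)
        - (if s = k ∧ t.val = l.val then deriv r (σ l) else 0) := by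
  rw [planeSkew, Matrix.sub_mul, single_mul_single_eq_ite, single_mul_single_eq_ite, dirD1_sub,
    dirD1_smul, dirD1_smul, dirD1_penalty_single hp hr hσ hinj, dirD1_penalty_single hp hr hσ hinj]
  simp only [ite_and, ite_mul, one_mul, zero_mul]

lemma dirD1_penalty_single_mul_planeSkew (hp : p₂ ≤ p₁) (hr : ContDiffOn ℝ 2 r (Set.Ioi 0))
    (hσ : ∀ j, 0 < σ j) (hinj : Function.Injective σ) (s t : Fin p₂) (k : Fin p₁) (l : Fin p₂) :
    dirD1 (penalty r) (rectDiag p₁ σ) (Matrix.single k l (1 : ℝ) * planeSkew s t)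
      = (if l = s ∧ k.val = t.val then deriv r (σ t) else 0)
        - (if l = t ∧ k.val = s.val then deriv r (σ s) else 0) := by
  rw [planeSkew, Matrix.mul_sub, single_mul_single_eq_ite, single_mul_single_eq_ite, dirD1_sub,
    dirD1_smul, dirD1_smul, dirD1_penalty_single hp hr hσ hinj, dirD1_penalty_single hp hr hσ hinj]
  simp only [ite_and, ite_mul, one_mul, zero_mul]

/-- Off the diagonal this is the elimination of `dirD1_penalty_offDiag` with nonzero right sides.
These involve only `DR` at the diagonal matrix, and vanish unless `(k, l)` is `(s, t)` or `(t, s)`.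
-/
theorem dirD2_penalty_rectDiag (hp : p₂ ≤ p₁) (hr : ContDiffOn ℝ 2 r (Set.Ioi 0))
    (hσ : ∀ j, 0 < σ j) (hinj : Function.Injective σ) (kl st : Fin p₁ × Fin p₂) :
    dirD2 (penalty r) (rectDiag p₁ σ) (Matrix.single st.1 st.2 1) (Matrix.single kl.1 kl.2 1)
      = hessG r σ kl st := by
  obtain ⟨k, l⟩ := kl
  obtain ⟨s, t⟩ := st
  have hS := contDiffAt_penalty_rectDiag hp r hr σ hσ hinj
  by_cases h : s.val = t.val
  · rw [dirD2_penalty_diag hp hr hσ hinj h]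
    simp [hessG, h, Prod.ext_iff]
  have hne : s ≠ Fin.castLE hp t := fun h' => h (by rw [h']; rfl)
  have hL := dirD2_penalty_planeSkew_mul hS hne (Matrix.single k l 1)
  rw [dirD1_penalty_planeSkew_mul_single hp hr hσ hinj, planeSkew, Matrix.sub_mul,
    single_mul_rectDiag_of_eq σ s (Fin.castLE hp t) (j := t) rfl] at hL
  by_cases hs : s.val < p₂
  · rw [single_mul_rectDiag_of_eq σ _ s (j := ⟨s, hs⟩) rfl] at hL
    have hne' : (⟨s, hs⟩ : Fin p₂) ≠ t := fun h' => h (congrArg Fin.val h')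
    have hR := dirD2_penalty_mul_planeSkew hS hne' (Matrix.single k l 1)
    rw [dirD1_penalty_single_mul_planeSkew hp hr hσ hinj, planeSkew, Matrix.mul_sub,
      rectDiag_mul_single σ t ⟨s, hs⟩ (k := s) rfl,
      rectDiag_mul_single σ ⟨s, hs⟩ t (k := Fin.castLE hp t) rfl] at hR
    simp only [dirD2_sub, dirD2_smul] at hL hR
    have hsq : σ ⟨s, hs⟩ ^ 2 - σ t ^ 2 ≠ 0 := sub_ne_zero.mpr fun h' =>
      hne' (hinj ((pow_left_inj₀ (hσ _).le (hσ _).le two_ne_zero).mp h'))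
    refine mul_left_cancel₀ hsq ?_
    have e1 : (Fin.castLE hp t = k ∧ s.val = l.val) ↔ (k.val = t.val ∧ l.val = s.val) := by
      rw [Fin.ext_iff]; simp [eq_comm]
    have e2 : (l = ⟨s, hs⟩ ∧ k.val = t.val) ↔ (k.val = t.val ∧ l.val = s.val) := by
      rw [Fin.ext_iff, and_comm]
    have e3 : (s = k ∧ (Fin.castLE hp t).val = l.val) ↔ (k, l) = (s, t) := by
      simp [Fin.ext_iff, eq_comm]
    have e4 : (l = t ∧ k.val = s.val) ↔ (k, l) = (s, t) := by
      simp [Fin.ext_iff, and_comm]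
    simp only [e1, e3] at hL
    simp only [e2, e4] at hR
    simp only [hessG, Matrix.of_apply, h, if_false, hs, dif_pos]
    by_cases h1 : (k, l) = (s, t)
    · have h2 : ¬ (k.val = t.val ∧ l.val = s.val) := by
        rw [Prod.mk.injEq] at h1
        rintro ⟨a, -⟩
        exact h (by rw [← h1.1, a])
      have hlt : l = t := (Prod.mk.inj h1).2
      simp only [h1, h2, if_true, if_false] at hL hR ⊢
      rw [mul_div_cancel₀ _ hsq]
      rw [hlt] at hL hR ⊢
      linear_combination σ ⟨s, hs⟩ * hR - σ t * hL
    · by_cases h2 : k.val = t.val ∧ l.val = s.val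
      · have hls : l = ⟨s, hs⟩ := Fin.ext h2.2
        simp only [h1, if_false, if_pos h2] at hL hR ⊢
        rw [mul_neg, mul_div_cancel₀ _ hsq]
        rw [hls] at hL hR ⊢
        linear_combination σ ⟨s, hs⟩ * hR - σ t * hL
      · simp only [h1, h2, if_false] at hL hR ⊢
        linear_combination σ ⟨s, hs⟩ * hR - σ t * hL
  -- Row `s` of the diagonal matrix is zero here, so the left rotation alone determines the entry,
  -- with divisor `σ t`.
  · rw [single_mul_rectDiag_of_le σ _ s (not_lt.mp hs)] at hL
    simp only [sub_zero, dirD2_smul] at hL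
    have e1 : ¬ (Fin.castLE hp t = k ∧ s.val = l.val) := fun ⟨_, a⟩ => hs (a ▸ l.isLt)
    have e3 : (s = k ∧ (Fin.castLE hp t).val = l.val) ↔ (k, l) = (s, t) := by
      simp [Fin.ext_iff, eq_comm]
    simp only [e1, e3, if_false] at hL
    simp only [hessG, Matrix.of_apply, h, if_false, hs, dif_neg, not_false_iff]
    refine mul_left_cancel₀ (hσ t).ne' ?_
    by_cases h1 : (k, l) = (s, t)
    · have hlt : l = t := (Prod.mk.inj h1).2
      rw [if_pos h1] at hL ⊢
      rw [hlt] at hL ⊢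
      rw [mul_div_cancel₀ _ (hσ t).ne']
      linear_combination hL
    · simp only [h1, if_false] at hL ⊢
      linear_combination hL

end RectDiag

/-! ### Rank one updates -/

section RankOne

variable {ι : Type*} [Fintype ι] [DecidableEq ι] {M : Matrix ι ι ℝ}

/-- Moving the rank one term to the right makes `M d` a multiple of `x`; only `M` has to be
invertible, not the update. -/
lemma rankOne_solve (hM : IsUnit M) (x d : ι → ℝ) (a b : ℝ)
    (hd : (M - a • Matrix.vecMulVec x x) *ᵥ d = b • x) :
    d = (a * (x ⬝ᵥ d) + b) • (M⁻¹ *ᵥ x) := by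
  have h1 : M *ᵥ d = (a * (x ⬝ᵥ d) + b) • x := by
    rw [Matrix.sub_mulVec, Matrix.smul_mulVec, Matrix.vecMulVec_mulVec, sub_eq_iff_eq_add] at hd
    rw [hd]
    ext k
    simp
    ring
  have h2 := congrArg (fun v => M⁻¹ *ᵥ v) h1
  simp only [Matrix.mulVec_mulVec, Matrix.mulVec_smul] at h2
  rwa [Matrix.nonsing_inv_mul _ ((Matrix.isUnit_iff_isUnit_det M).mp hM), Matrix.one_mulVec] at h2

lemma rankOne_dotProduct (hM : IsUnit M) (x d : ι → ℝ) (a b : ℝ)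
    (hd : (M - a • Matrix.vecMulVec x x) *ᵥ d = b • x) :
    (x ⬝ᵥ d) * (1 - (x ⬝ᵥ M⁻¹ *ᵥ x) * a) = (x ⬝ᵥ M⁻¹ *ᵥ x) * b := by
  have h := congrArg (fun v => x ⬝ᵥ v) (rankOne_solve hM x d a b hd)
  simp only [dotProduct_smul, smul_eq_mul] at h
  linear_combination h

/-- A rank one update of a nonsingular matrix is nonsingular iff `1 - a xᵀM⁻¹x ≠ 0`. -/
lemma isUnit_sub_rankOne_iff (hM : IsUnit M) (x : ι → ℝ) (a : ℝ) :
    IsUnit (M - a • Matrix.vecMulVec x x) ↔ 1 - (x ⬝ᵥ M⁻¹ *ᵥ x) * a ≠ 0 := by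
  rw [← Matrix.mulVec_injective_iff_isUnit]
  constructor
  · intro hinj h0
    -- If the denominator vanishes, `M⁻¹x` lies in the kernel of the update. Injectivity makes it
    -- zero, and then `h0` reads `1 = 0`.
    have hd : M⁻¹ *ᵥ x = 0 := by
      refine hinj ?_
      simp only [Matrix.mulVec_zero]
      rw [Matrix.sub_mulVec, Matrix.smul_mulVec, Matrix.vecMulVec_mulVec, Matrix.mulVec_mulVec,
        Matrix.mul_nonsing_inv _ ((Matrix.isUnit_iff_isUnit_det M).mp hM), Matrix.one_mulVec]
      ext k
      simp only [Pi.sub_apply, Pi.smul_apply, MulOpposite.smul_eq_mul_unop,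
        MulOpposite.unop_op, smul_eq_mul, Pi.zero_apply]
      linear_combination x k * h0
    rw [hd] at h0
    simp at h0
  · intro h0
    refine (injective_iff_map_eq_zero (M - a • Matrix.vecMulVec x x).mulVecLin).mpr fun d hd => ?_
    have hd' : (M - a • Matrix.vecMulVec x x) *ᵥ d = (0 : ℝ) • x := by
      rw [zero_smul]; exact hd
    have h1 := rankOne_dotProduct hM x d a 0 hd'
    have h2 : x ⬝ᵥ d = 0 := (mul_eq_zero.mp (h1.trans (mul_zero _))).resolve_right h0
    rw [rankOne_solve hM x d a 0 hd', h2]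
    simp

end RankOne

/-! ### Derivatives of a sum of losses plus a penalty -/

section Composite

variable {E : Type*} [NormedAddCommGroup E] [NormedSpace ℝ E]

lemma dirD2_sum_smul {ι κ : Type*} [Fintype ι] [Fintype κ] (f : E → ℝ) (x : E) (a : ι → ℝ)
    (v : ι → E) (b : κ → ℝ) (w : κ → E) :
    dirD2 f x (∑ i, a i • v i) (∑ j, b j • w j) = ∑ j, b j * ∑ i, dirD2 f x (v i) (w j) * a i := by
  simp only [dirD2, map_sum, map_smul, smul_eq_mul]
  refine Finset.sum_congr rfl fun j _ => ?_
  simp [mul_comm]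

variable [FiniteDimensional ℝ E] {ι : Type*} {S : Finset ι} {g : ι → ℝ → ℝ} {φ : ι → E →ₗ[ℝ] ℝ}
  {P : E → ℝ} {c : ℝ} {x : E}

lemma contDiffAt_sum_comp_add (hg : ∀ j, ContDiff ℝ 2 (g j)) (hP : ContDiffAt ℝ 2 P x) :
    ContDiffAt ℝ 2 (fun z => ∑ j ∈ S, g j (φ j z) + c * P z) x := by
  refine ContDiffAt.add (ContDiffAt.sum fun j _ => ?_) (contDiffAt_const.mul hP)
  exact ((hg j).comp (LinearMap.toContinuousLinearMap (φ j)).contDiff).contDiffAt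

lemma dirD1_sum_comp_add (hg : ∀ j, ContDiff ℝ 2 (g j)) (hP : ContDiffAt ℝ 2 P x) (v : E) :
    dirD1 (fun z => ∑ j ∈ S, g j (φ j z) + c * P z) x v
      = ∑ j ∈ S, deriv (g j) (φ j x) * φ j v + c * dirD1 P x v := by
  refine dirD1_eq_of_curve (contDiffAt_sum_comp_add hg hP) (isVelocity_line x v) (by simp) ?_
  refine HasDerivAt.add (HasDerivAt.fun_sum fun j _ => ?_) (HasDerivAt.const_mul c ?_)
  · have h : HasDerivAt (g j) (deriv (g j) (φ j x)) (φ j (x + (0 : ℝ) • v)) := by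
      simpa using ((hg j).differentiable (by norm_num) (φ j x)).hasDerivAt
    exact h.comp 0 (hasDerivAt_linear_line (φ j) x v)
  · have h : HasFDerivAt P (fderiv ℝ P x) (x + (0 : ℝ) • v) := by
      simpa using (hP.differentiableAt (by norm_num)).hasFDerivAt
    exact h.comp_hasDerivAt 0 (isVelocity_line x v)

lemma dirD2_sum_comp_add (hg : ∀ j, ContDiff ℝ 2 (g j)) (hP : ContDiffAt ℝ 2 P x) (v w : E) :
    dirD2 (fun z => ∑ j ∈ S, g j (φ j z) + c * P z) x v w
      = ∑ j ∈ S, deriv (deriv (g j)) (φ j x) * φ j v * φ j w + c * dirD2 P x v w := by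
  -- Differentiating the gradient formula requires it near `x`, so C² regularity at `x` is first
  -- spread to nearby points of the line.
  have hev : ∀ᶠ t : ℝ in 𝓝 0, ContDiffAt ℝ 2 P (x + t • v) := by
    have h := hP.eventually (by simp)
    rw [show x = x + (0 : ℝ) • v by simp] at h
    have hc : ContinuousAt (fun t : ℝ => x + t • v) 0 := by fun_prop
    exact hc.eventually h
  refine (hasDerivAt_dirD1_line (contDiffAt_sum_comp_add hg hP) v w).unique ?_
  have hd : HasDerivAt (fun t : ℝ => ∑ j ∈ S, deriv (g j) (φ j (x + t • v)) * φ j w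
      + c * dirD1 P (x + t • v) w)
      (∑ j ∈ S, deriv (deriv (g j)) (φ j x) * φ j v * φ j w + c * dirD2 P x v w) 0 := by
    refine HasDerivAt.add (HasDerivAt.fun_sum fun j _ => ?_)
      ((hasDerivAt_dirD1_line hP v w).const_mul c)
    have h : HasDerivAt (deriv (g j)) (deriv (deriv (g j)) (φ j x)) (φ j (x + (0 : ℝ) • v)) := by
      have := hasDerivAt_deriv_of_contDiffAt (hg j).contDiffAt (x := φ j x)
      simpa using this
    exact (h.comp 0 (hasDerivAt_linear_line (φ j) x v)).mul_const (φ j w)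
  refine hd.congr_of_eventuallyEq ?_
  filter_upwards [hev] with t ht using dirD1_sum_comp_add hg ht w

end Composite

lemma isInvertible_of_bijective {E F : Type*} [AddCommGroup E] [Module ℝ E] [TopologicalSpace E]
    [IsTopologicalAddGroup E] [ContinuousSMul ℝ E] [T2Space E] [FiniteDimensional ℝ E]
    [AddCommGroup F] [Module ℝ F] [TopologicalSpace F]
    [IsTopologicalAddGroup F] [ContinuousSMul ℝ F] [T2Space F]
    (T : E →L[ℝ] F) (hT : Function.Bijective T) : T.IsInvertible := by
  let L : E ≃ₗ[ℝ] F := LinearEquiv.ofBijective T.toLinearMap hT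
  exact ⟨L.toContinuousLinearEquiv, ContinuousLinearMap.ext fun _ => rfl⟩

/-! ### The objective in the coordinates `u_k v_lᵀ` -/

section Objective

variable {n p₁ p₂ : ℕ}

/-- `matInner X` as a linear form. -/
def matInnerLin (X : Matrix (Fin p₁) (Fin p₂) ℝ) : Matrix (Fin p₁) (Fin p₂) ℝ →ₗ[ℝ] ℝ where
  toFun := matInner X
  map_add' B C := by simp [matInner, Matrix.mul_add]
  map_smul' c B := by simp [matInner]

/-- The matrix with coordinates `d` in the basis `u_k v_lᵀ`. -/
def assemble {U : Matrix (Fin p₁) (Fin p₁) ℝ} {V : Matrix (Fin p₂) (Fin p₂) ℝ}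
    (hU : Uᵀ * U = 1) (hV : Vᵀ * Vᵀᵀ = 1) :
    (Fin p₁ × Fin p₂ → ℝ) ≃ₗ[ℝ] Matrix (Fin p₁) (Fin p₂) ℝ :=
  (LinearEquiv.curry ℝ ℝ (Fin p₁) (Fin p₂)).trans (orthoEquiv U Vᵀ hU hV)

variable {U : Matrix (Fin p₁) (Fin p₁) ℝ} {V : Matrix (Fin p₂) (Fin p₂) ℝ}

lemma orthoEquiv_single (hU : Uᵀ * U = 1) (hV : Vᵀ * Vᵀᵀ = 1) (s : Fin p₁) (t : Fin p₂) :
    orthoEquiv U Vᵀ hU hV (Matrix.single s t 1) = Matrix.vecMulVec (U.col s) (V.col t) := by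
  rw [orthoEquiv_apply]
  ext a b
  simp [Matrix.mul_apply, Matrix.single_apply, Matrix.vecMulVec_apply, ite_and]

lemma assemble_eq_sum (hU : Uᵀ * U = 1) (hV : Vᵀ * Vᵀᵀ = 1) (d : Fin p₁ × Fin p₂ → ℝ) :
    assemble hU hV d = ∑ kl, d kl • Matrix.vecMulVec (U.col kl.1) (V.col kl.2) := by
  have h : LinearEquiv.curry ℝ ℝ (Fin p₁) (Fin p₂) d
      = ∑ kl : Fin p₁ × Fin p₂, d kl • Matrix.single kl.1 kl.2 (1 : ℝ) := by
    funext a b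
    rw [Matrix.sum_apply, Finset.sum_eq_single (a, b)]
    · simp
    · rintro ⟨k, l⟩ _ hne
      have : ¬ (k = a ∧ l = b) := fun ⟨h1, h2⟩ => hne (by rw [h1, h2])
      simp [this]
    · simp
  change orthoEquiv U Vᵀ hU hV (LinearEquiv.curry ℝ ℝ (Fin p₁) (Fin p₂) d) = _
  refine (congrArg (orthoEquiv U Vᵀ hU hV) h).trans ?_
  rw [map_sum]
  exact Finset.sum_congr rfl fun kl _ => by rw [map_smul, orthoEquiv_single]

lemma matInner_vecMulVec (X : Fin n → Matrix (Fin p₁) (Fin p₂) ℝ) (j : Fin n)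
    (kl : Fin p₁ × Fin p₂) :
    matInner (X j) (Matrix.vecMulVec (U.col kl.1) (V.col kl.2)) = designX X U V j kl := by
  rw [matInner, Matrix.mul_vecMulVec, Matrix.trace_vecMulVec, designX, Matrix.of_apply,
    Matrix.mulVec_transpose, Matrix.dotProduct_mulVec]

lemma matInner_assemble (hU : Uᵀ * U = 1) (hV : Vᵀ * Vᵀᵀ = 1)
    (X : Fin n → Matrix (Fin p₁) (Fin p₂) ℝ) (j : Fin n) (d : Fin p₁ × Fin p₂ → ℝ) :
    matInner (X j) (assemble hU hV d) = designX X U V j ⬝ᵥ d := by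
  rw [assemble_eq_sum]
  change matInnerLin (X j) _ = _
  rw [map_sum]
  refine Finset.sum_congr rfl fun kl _ => ?_
  rw [map_smul, smul_eq_mul, mul_comm]
  exact congrArg (· * d kl) (matInner_vecMulVec X j kl)

/-- A bilinear form with matrix `N` in some coordinates is invertible iff `N` is nonsingular. -/
lemma isInvertible_iff_isUnit {ι : Type*} [Fintype ι] [DecidableEq ι]
    (T : Matrix (Fin p₁) (Fin p₂) ℝ →L[ℝ] (Matrix (Fin p₁) (Fin p₂) ℝ →L[ℝ] ℝ))
    (e : (ι → ℝ) ≃ₗ[ℝ] Matrix (Fin p₁) (Fin p₂) ℝ) (N : Matrix ι ι ℝ)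
    (h : ∀ d c, T (e d) (e c) = c ⬝ᵥ N *ᵥ d) : T.IsInvertible ↔ IsUnit N := by
  rw [← Matrix.mulVec_injective_iff_isUnit]
  constructor
  · intro hT
    refine (injective_iff_map_eq_zero N.mulVecLin).mpr fun d hd => ?_
    have hd' : N *ᵥ d = 0 := hd
    have h0 : T (e d) = 0 := by
      ext Z
      obtain ⟨c, rfl⟩ := e.surjective Z
      rw [h, hd']
      simp
    have := hT.injective (h0.trans (map_zero T).symm)
    simpa using this
  · intro hN
    have hNu := Matrix.mulVec_injective_iff_isUnit.mp hN
    have hinj : Function.Injective T := by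
      refine (injective_iff_map_eq_zero T).mpr fun Z hZ => ?_
      obtain ⟨d, rfl⟩ := e.surjective Z
      have hd : N *ᵥ d = 0 := by
        refine dotProduct_eq_zero _ fun c => ?_
        rw [dotProduct_comm, ← h, hZ]
        rfl
      rw [hN (hd.trans (Matrix.mulVec_zero N).symm), map_zero]
    have hsurj : Function.Surjective T := by
      intro ψ
      -- The vector under `N⁻¹` lists the values of `ψ` on the coordinate basis, so this solves the
      -- linear system representing `T Z = ψ`.
      refine ⟨e (N⁻¹ *ᵥ fun i => ψ (e (Pi.single i 1))), ?_⟩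
      ext Z
      obtain ⟨c, rfl⟩ := e.surjective Z
      rw [h, Matrix.mulVec_mulVec,
        Matrix.mul_nonsing_inv _ ((Matrix.isUnit_iff_isUnit_det N).mp hNu), Matrix.one_mulVec]
      conv_rhs => rw [pi_eq_sum_univ' c]
      simp only [map_sum, map_smul, smul_eq_mul]
      rfl
    exact isInvertible_of_bijective T ⟨hinj, hsurj⟩

variable {r : ℝ → ℝ} {σ : Fin p₂ → ℝ}

lemma contDiffAt_penalty_svd (hp : p₂ ≤ p₁) (hr : ContDiffOn ℝ 2 r (Set.Ioi 0))
    (hσ : ∀ j, 0 < σ j) (hinj : Function.Injective σ) (hU : Uᵀ * U = 1) (hV : Vᵀ * Vᵀᵀ = 1) :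
    ContDiffAt ℝ 2 (penalty r) (U * rectDiag p₁ σ * Vᵀ) :=
  contDiffAt_linearEquiv (orthoEquiv U Vᵀ hU hV) (fun Y => penalty_orthogonal r Y hU hV)
    (contDiffAt_penalty_rectDiag hp r hr σ hσ hinj)

lemma dirD2_penalty_svd (hp : p₂ ≤ p₁) (hr : ContDiffOn ℝ 2 r (Set.Ioi 0))
    (hσ : ∀ j, 0 < σ j) (hinj : Function.Injective σ) (hU : Uᵀ * U = 1) (hV : Vᵀ * Vᵀᵀ = 1)
    (kl st : Fin p₁ × Fin p₂) :
    dirD2 (penalty r) (U * rectDiag p₁ σ * Vᵀ) (Matrix.vecMulVec (U.col st.1) (V.col st.2))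
      (Matrix.vecMulVec (U.col kl.1) (V.col kl.2)) = hessG r σ kl st := by
  have h := dirD2_linearEquiv (orthoEquiv U Vᵀ hU hV) (fun Y => penalty_orthogonal r Y hU hV)
    (contDiffAt_penalty_rectDiag hp r hr σ hσ hinj) (Matrix.single st.1 st.2 1)
    (Matrix.single kl.1 kl.2 1)
  rw [orthoEquiv_single, orthoEquiv_single, dirD2_penalty_rectDiag hp hr hσ hinj] at h
  exact h

lemma dirD2_penalty_assemble (hp : p₂ ≤ p₁) (hr : ContDiffOn ℝ 2 r (Set.Ioi 0))
    (hσ : ∀ j, 0 < σ j) (hinj : Function.Injective σ) (hU : Uᵀ * U = 1) (hV : Vᵀ * Vᵀᵀ = 1)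
    (d c : Fin p₁ × Fin p₂ → ℝ) :
    dirD2 (penalty r) (U * rectDiag p₁ σ * Vᵀ) (assemble hU hV d) (assemble hU hV c)
      = c ⬝ᵥ hessG r σ *ᵥ d := by
  rw [assemble_eq_sum, assemble_eq_sum, dirD2_sum_smul]
  simp only [dirD2_penalty_svd hp hr hσ hinj hU hV]
  rfl

variable {ℓ : ℝ → ℝ → ℝ} {X : Fin n → Matrix (Fin p₁) (Fin p₂) ℝ} {y : Fin n → ℝ} {lam : ℝ}
  {B : Matrix (Fin p₁) (Fin p₂) ℝ}

lemma dirD1_objective (hℓ : ∀ j, ContDiff ℝ 2 fun u => ℓ u (y j))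
    (hP : ContDiffAt ℝ 2 (penalty r) B) (S : Finset (Fin n)) (K : Matrix (Fin p₁) (Fin p₂) ℝ) :
    dirD1 (objective ℓ X y lam r S) B K
      = ∑ j ∈ S, lossD1 ℓ (matInner (X j) B) (y j) * matInner (X j) K
        + lam * dirD1 (penalty r) B K :=
  dirD1_sum_comp_add (φ := fun j => matInnerLin (X j)) hℓ hP K

lemma dirD2_objective (hℓ : ∀ j, ContDiff ℝ 2 fun u => ℓ u (y j))
    (hP : ContDiffAt ℝ 2 (penalty r) B) (S : Finset (Fin n)) (D K : Matrix (Fin p₁) (Fin p₂) ℝ) :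
    dirD2 (objective ℓ X y lam r S) B D K
      = ∑ j ∈ S, lossD2 ℓ (matInner (X j) B) (y j) * matInner (X j) D * matInner (X j) K
        + lam * dirD2 (penalty r) B D K :=
  dirD2_sum_comp_add (φ := fun j => matInnerLin (X j)) hℓ hP D K

lemma dotProduct_bracket_mulVec (d c : Fin p₁ × Fin p₂ → ℝ) :
    c ⬝ᵥ bracket ℓ X y lam r B U σ V *ᵥ d
      = ∑ j, lossD2 ℓ (matInner (X j) B) (y j) * (designX X U V j ⬝ᵥ d) * (designX X U V j ⬝ᵥ c)
        + lam * (c ⬝ᵥ hessG r σ *ᵥ d) := by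
  rw [bracket, Matrix.add_mulVec, dotProduct_add, Matrix.smul_mulVec, dotProduct_smul, smul_eq_mul,
    ← Matrix.mulVec_mulVec, ← Matrix.mulVec_mulVec, Matrix.dotProduct_mulVec,
    Matrix.vecMul_transpose]
  congr 1
  refine Finset.sum_congr rfl fun j _ => ?_
  rw [Matrix.mulVec_diagonal]
  simp only [Matrix.mulVec]
  ring

lemma hatH_diag (i : Fin n) :
    hatH ℓ X y lam r B U σ V i i
      = designX X U V i ⬝ᵥ (bracket ℓ X y lam r B U σ V)⁻¹ *ᵥ designX X U V i := by
  rw [hatH, Matrix.mul_assoc]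
  rfl

lemma dirD1_objective_eq_zero (hB : ∀ B', objective ℓ X y lam r Finset.univ B
      ≤ objective ℓ X y lam r Finset.univ B') (K : Matrix (Fin p₁) (Fin p₂) ℝ) :
    dirD1 (objective ℓ X y lam r Finset.univ) B K = 0 := by
  have h : IsLocalMin (objective ℓ X y lam r Finset.univ) B := Filter.Eventually.of_forall hB
  rw [dirD1, h.fderiv_eq_zero]
  rfl

/-- The minimizer is stationary for the full objective, so the penalty gradient and the other losses
cancel against the omitted term. -/
lemma dirD1_objective_erase (hℓ : ∀ j, ContDiff ℝ 2 fun u => ℓ u (y j))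
    (hP : ContDiffAt ℝ 2 (penalty r) B) (hB : ∀ B', objective ℓ X y lam r Finset.univ B
      ≤ objective ℓ X y lam r Finset.univ B') (i : Fin n) (K : Matrix (Fin p₁) (Fin p₂) ℝ) :
    dirD1 (objective ℓ X y lam r (Finset.univ.erase i)) B K
      = -(lossD1 ℓ (matInner (X i) B) (y i) * matInner (X i) K) := by
  have h0 := dirD1_objective_eq_zero hB K
  rw [dirD1_objective hℓ hP, ← Finset.add_sum_erase _ _ (Finset.mem_univ i)] at h0
  rw [dirD1_objective hℓ hP]
  linear_combination h0

lemma dirD2_objective_assemble (hp : p₂ ≤ p₁)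
    (hℓ : ∀ j, ContDiff ℝ 2 fun u => ℓ u (y j)) (hr : ContDiffOn ℝ 2 r (Set.Ioi 0))
    (hσ : ∀ j, 0 < σ j) (hinj : Function.Injective σ) (hU : Uᵀ * U = 1) (hV : Vᵀ * Vᵀᵀ = 1)
    (hsvd : B = U * rectDiag p₁ σ * Vᵀ) (d c : Fin p₁ × Fin p₂ → ℝ) :
    dirD2 (objective ℓ X y lam r Finset.univ) B (assemble hU hV d) (assemble hU hV c)
      = c ⬝ᵥ bracket ℓ X y lam r B U σ V *ᵥ d := by
  have hP : ContDiffAt ℝ 2 (penalty r) B := hsvd ▸ contDiffAt_penalty_svd hp hr hσ hinj hU hV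
  have hG : dirD2 (penalty r) B (assemble hU hV d) (assemble hU hV c) = c ⬝ᵥ hessG r σ *ᵥ d :=
    hsvd ▸ dirD2_penalty_assemble hp hr hσ hinj hU hV d c
  rw [dirD2_objective hℓ hP, dotProduct_bracket_mulVec, hG]
  simp only [matInner_assemble]

lemma dirD2_objective_erase_assemble (hp : p₂ ≤ p₁)
    (hℓ : ∀ j, ContDiff ℝ 2 fun u => ℓ u (y j)) (hr : ContDiffOn ℝ 2 r (Set.Ioi 0))
    (hσ : ∀ j, 0 < σ j) (hinj : Function.Injective σ) (hU : Uᵀ * U = 1) (hV : Vᵀ * Vᵀᵀ = 1)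
    (hsvd : B = U * rectDiag p₁ σ * Vᵀ) (i : Fin n)
    (d c : Fin p₁ × Fin p₂ → ℝ) :
    dirD2 (objective ℓ X y lam r (Finset.univ.erase i)) B (assemble hU hV d) (assemble hU hV c)
      = c ⬝ᵥ (bracket ℓ X y lam r B U σ V - lossD2 ℓ (matInner (X i) B) (y i) •
        Matrix.vecMulVec (designX X U V i) (designX X U V i)) *ᵥ d := by
  have hP : ContDiffAt ℝ 2 (penalty r) B := hsvd ▸ contDiffAt_penalty_svd hp hr hσ hinj hU hV
  have h := dirD2_objective_assemble (X := X) (lam := lam) hp hℓ hr hσ hinj hU hV hsvd d c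
  rw [dirD2_objective hℓ hP, ← Finset.add_sum_erase _ _ (Finset.mem_univ i)] at h
  rw [Matrix.sub_mulVec, dotProduct_sub, ← h, dirD2_objective hℓ hP, Matrix.smul_mulVec,
    Matrix.vecMulVec_mulVec, matInner_assemble, matInner_assemble]
  simp only [dotProduct_smul, smul_eq_mul, MulOpposite.smul_eq_mul_unop, MulOpposite.unop_op]
  rw [dotProduct_comm c]
  ring

end Objective

end

end ALO

/-! ### The approximate leave-one-out formula -/

theorem mainTheorem7 {n p₁ p₂ : ℕ} (hp : p₂ ≤ p₁)
    (ℓ : ℝ → ℝ → ℝ) (X : Fin n → Matrix (Fin p₁) (Fin p₂) ℝ) (y : Fin n → ℝ)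
    (lam : ℝ) (r : ℝ → ℝ)
    (hℓ : ∀ j, ContDiff ℝ 2 fun u => ℓ u (y j))
    (hr : ContDiffOn ℝ 2 r (Set.Ioi 0))
    (B : Matrix (Fin p₁) (Fin p₂) ℝ)
    -- `B` is the full data estimator
    (hB : ∀ B', ALO.objective ℓ X y lam r Finset.univ B
      ≤ ALO.objective ℓ X y lam r Finset.univ B')
    -- `B = U diag[σ] Vᵀ` is a singular value decomposition, with distinct nonzero singular values
    (U : Matrix (Fin p₁) (Fin p₁) ℝ) (σ : Fin p₂ → ℝ) (V : Matrix (Fin p₂) (Fin p₂) ℝ)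
    (hU : U ∈ Matrix.orthogonalGroup (Fin p₁) ℝ) (hV : V ∈ Matrix.orthogonalGroup (Fin p₂) ℝ)
    (hsvd : B = U * ALO.rectDiag p₁ σ * Vᵀ)
    (hσ : ∀ j, 0 < σ j) (hσ_inj : Function.Injective σ) :
    -- the penalty is twice continuously differentiable near `B`, with Hessian `𝒢` in the
    -- basis `u_k v_lᵀ`
    ContDiffAt ℝ 2 (ALO.penalty r) B ∧
    (∀ kl st : Fin p₁ × Fin p₂,
      ALO.hessian (ALO.penalty r) B (Matrix.vecMulVec (U.col st.1) (V.col st.2))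
        (Matrix.vecMulVec (U.col kl.1) (V.col kl.2)) = ALO.hessG r σ kl st) ∧
    -- the matrix inverted in `H` is nonsingular exactly when the full data Hessian is
    (IsUnit (ALO.bracket ℓ X y lam r B U σ V) ↔
      (ALO.hessian (ALO.objective ℓ X y lam r Finset.univ) B).IsInvertible) ∧
    ∀ i : Fin n, IsUnit (ALO.bracket ℓ X y lam r B U σ V) →
      -- the leave-`i`-out Hessian is invertible exactly when the denominator is nonzero
      ((ALO.hessian (ALO.objective ℓ X y lam r (Finset.univ.erase i)) B).IsInvertible ↔
        1 - ALO.hatH ℓ X y lam r B U σ V i i * ALO.lossD2 ℓ (ALO.matInner (X i) B) (y i) ≠ 0) ∧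
      -- and then the approximate leave-one-out formula holds
      ((ALO.hessian (ALO.objective ℓ X y lam r (Finset.univ.erase i)) B).IsInvertible →
        ALO.matInner (X i) (ALO.aloEstimator ℓ X y lam r B i) =
          ALO.matInner (X i) B +
            ALO.hatH ℓ X y lam r B U σ V i i * ALO.lossD1 ℓ (ALO.matInner (X i) B) (y i) /
              (1 - ALO.hatH ℓ X y lam r B U σ V i i *
                ALO.lossD2 ℓ (ALO.matInner (X i) B) (y i))) := by
  have hU' : Uᵀ * U = 1 := (Matrix.mem_orthogonalGroup_iff' _ _).mp hU
  -- The shape `W * Wᵀ = 1` of `orthoEquiv`, at `W = Vᵀ`.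
  have hV' : Vᵀ * Vᵀᵀ = 1 := by
    rw [Matrix.transpose_transpose]
    exact (Matrix.mem_orthogonalGroup_iff' _ _).mp hV
  have hP : ContDiffAt ℝ 2 (ALO.penalty r) B :=
    hsvd ▸ ALO.contDiffAt_penalty_svd hp hr hσ hσ_inj hU' hV'
  have hM := fun d c => ALO.dirD2_objective_assemble (X := X) (lam := lam) hp hℓ hr hσ hσ_inj hU' hV'
    hsvd d c
  have hMi := fun i d c => ALO.dirD2_objective_erase_assemble (X := X) (lam := lam) hp hℓ hr hσ
    hσ_inj hU' hV' hsvd i d c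
  refine ⟨hP, fun kl st => ?_, ?_, fun i hunit => ?_⟩
  · subst hsvd
    exact ALO.dirD2_penalty_svd hp hr hσ hσ_inj hU' hV' kl st
  · exact (ALO.isInvertible_iff_isUnit _ (ALO.assemble hU' hV') _ hM).symm
  have hiff : (ALO.hessian (ALO.objective ℓ X y lam r (Finset.univ.erase i)) B).IsInvertible ↔
      1 - ALO.hatH ℓ X y lam r B U σ V i i * ALO.lossD2 ℓ (ALO.matInner (X i) B) (y i) ≠ 0 := by
    rw [ALO.hatH_diag]
    exact (ALO.isInvertible_iff_isUnit _ (ALO.assemble hU' hV') _ (hMi i)).trans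
      (ALO.isUnit_sub_rankOne_iff hunit _ _)
  refine ⟨hiff, fun hinv => ?_⟩
  have hne := hiff.mp hinv
  set F := ALO.objective ℓ X y lam r (Finset.univ.erase i) with hF
  -- `d` holds the coordinates of the Newton displacement, which is subtracted from `B`.
  obtain ⟨d, hd⟩ := (ALO.assemble hU' hV').surjective
    ((ALO.hessian F B).inverse (fderiv ℝ F B))
  have hsolve : ALO.hessian F B (ALO.assemble hU' hV' d) = fderiv ℝ F B := by
    rw [hd]
    exact hinv.self_apply_inverse _
  have hvec : (ALO.bracket ℓ X y lam r B U σ V - ALO.lossD2 ℓ (ALO.matInner (X i) B) (y i) •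
      Matrix.vecMulVec (ALO.designX X U V i) (ALO.designX X U V i)) *ᵥ d
      = (-ALO.lossD1 ℓ (ALO.matInner (X i) B) (y i)) • ALO.designX X U V i := by
    -- The Newton equation is an equality of linear forms; testing it on every coordinate vector `c`
    -- gives the vector equation.
    refine sub_eq_zero.mp (dotProduct_eq_zero _ fun c => ?_)
    have h1 : ALO.dirD2 F B (ALO.assemble hU' hV' d) (ALO.assemble hU' hV' c)
        = ALO.dirD1 F B (ALO.assemble hU' hV' c) :=
      congrArg (fun T => T (ALO.assemble hU' hV' c)) hsolve
    rw [hMi i, ALO.dirD1_objective_erase hℓ hP hB, ALO.matInner_assemble] at h1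
    rw [dotProduct_comm, dotProduct_sub, h1, dotProduct_smul, smul_eq_mul, dotProduct_comm c]
    ring
  have hq := ALO.rankOne_dotProduct hunit _ _ _ _ hvec
  rw [← ALO.hatH_diag] at hq
  have hstep : ALO.matInner (X i) (ALO.aloEstimator ℓ X y lam r B i)
      = ALO.matInner (X i) B - ALO.designX X U V i ⬝ᵥ d := by
    rw [← ALO.matInner_assemble hU' hV', hd]
    exact map_sub (ALO.matInnerLin (X i)) _ _
  rw [hstep, sub_eq_add_neg, add_right_inj, eq_div_iff hne]
  linear_combination -hq
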